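/- Let $d\ge 1$, $a_0,r_0,\beta>0$ and $\alpha<1$ with $\alpha+\beta>1$, and put $H:=\frac{\alpha+2\beta-1}{2\beta}\in(\frac12,1)$. Let $L^2_{(s)}(\mathbb R^{1+d})$ be the real Hilbert space of all $\varphi\in L^2(\mathbb R^{1+d};\mathbb C)$ with $\overline{\varphi(s,k)}=\varphi(s,-k)$, with scalar product $\langle\varphi,\psi\rangle=\int\varphi(s,k)\psi(s,-k)\,ds\,dk$, and let $W=(W_1,\dots,W_d)$ be a $d$-dimensional space-time white noise on a probability space: the $\langle \varphi,W_j\rangle$, $\varphi\in L^2_{(s)}(\mathbb R^{1+d})$, $1\le j\le d$, are real, jointly Gaussian and centered, with $\mathbb E[\langle\varphi,W_j\rangle\langle\psi,W_{j'}\rangle]=\delta_{jj'}\langle\varphi,\psi\rangle$. Let $$E_\infty(s,s',k,k'):=a_0r_0\Big(\frac1{|k||k'|}\Big)^{(\alpha+d-1)/2-\beta}\exp\Big\{-\frac{r_0}2\big[|k|^{2\beta}|s|+|k'|^{2\beta}|s'|\big]\Big\}$$ and, for $t\ge0$ and $j=1,\dots,d$, $$Z_j(t):=\int_0^t d\sigma\int_{(-\infty,\sigma]^2}\int_{\mathbb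 R^{2d}}E_\infty(\sigma-s,\sigma-s',k,k')\,W_j(ds,dk)\,W_j(ds',dk'),$$ understood as the double Wiener integral with respect to $W_j$ of the kernel $\int_0^t 1_{(-\infty,\sigma]^2}(s,s')E_\infty(\sigma-s,\sigma-s',k,k')\,d\sigma$. Then this kernel is square integrable, so that each $Z_j(t)$ is well defined up to almost sure equality, and $Z=(Z_1,\dots,Z_d)$ is a $d$-dimensional Rosenblatt process of index $H$. That is, the processes $(Z_1(t))_{t\ge0},\dots,(Z_d(t))_{t\ge0}$ are independent, and for each $j$ there are a constant $c>0$ and a one-dimensional real white noise $B$ on $\mathbb R$, defined on the same probability space, such that for every $t\ge0$, almost surely, $$Z_j(t)=c\int_{\mathbb R^2}\Big\{\int_0^t(s-y_1)_+^{-(1-H/2)}(s-y_2)_+^{-(1-H/2)}\,ds\Big\}\,B(dy_1)\,B(dy_2).$$ -/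

import Mathlib

open MeasureTheory ProbabilityTheory Filter Topology
open scoped NNReal ENNReal

namespace ChaosProcess

/-- The real space `L²_(s)` of square-integrable complex functions `φ` on `E` with the symmetry
`φ(x)^* = φ(τ x)`, for an involution `τ` of `E`.
For `τ = id` this is the space of real-valued square-integrable functions.
Functions that agree almost everywhere are not identified here. -/
def SymmL2 {E : Type*} [MeasureSpace E] (τ : E → E) : Type _ :=
  {φ : E → ℂ // MemLp φ 2 (volume : Measure E) ∧
    ∀ᵐ x ∂(volume : Measure E), (starRingEnd ℂ) (φ x) = φ (τ x)}

/-- The scalar product `∫ φ(x) ψ(τ x) dx` of `L²_(s)`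
(the integral is a real number when `τ` is a measure-preserving involution). -/
noncomputable def pairing {E : Type*} [MeasureSpace E] {τ : E → E} (φ ψ : SymmL2 τ) : ℝ :=
  (∫ x, φ.1 x * ψ.1 (τ x)).re

/-- `W = (W_j)_{j ∈ ι}` is a vector valued white noise: the variables `⟨φ, W_j⟩ = W j φ` are real
valued, jointly Gaussian, centered, and
`𝔼[⟨φ, W_j⟩ ⟨ψ, W_{j'}⟩] = δ_{j j'} ⟨φ, ψ⟩`. -/
structure IsWhiteNoise {Ω : Type*} [MeasurableSpace Ω] (P : Measure Ω) {E : Type*} [MeasureSpace E]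
    (τ : E → E) {ι : Type*} [DecidableEq ι] (W : ι → SymmL2 τ → Ω → ℝ) : Prop where
  gaussian : IsGaussianProcess (fun q : ι × SymmL2 τ => W q.1 q.2) P
  mean : ∀ j φ, ∫ ω, W j φ ω ∂P = 0
  cov : ∀ j j' φ ψ, ∫ ω, W j φ ω * W j' ψ ω ∂P = if j = j' then pairing φ ψ else 0

/-- The kernel `∑ᵢ φᵢ ⊗ ψᵢ` given by a finite list of pairs `(φᵢ, ψᵢ)`. -/
noncomputable def elemKernel {E : Type*} [MeasureSpace E] {τ : E → E}
    (l : List (SymmL2 τ × SymmL2 τ)) (p : E × E) : ℂ :=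
  (l.map fun q => q.1.1 p.1 * q.2.1 p.2).sum

/-- The double stochastic integral of `∑ᵢ φᵢ ⊗ ψᵢ`, that is, the sum of the Wick products
`⟨φᵢ, W⟩ ⟨ψᵢ, W⟩ - ⟨φᵢ, ψᵢ⟩`. -/
noncomputable def elemIntegral {Ω : Type*} {E : Type*} [MeasureSpace E] {τ : E → E}
    (W : SymmL2 τ → Ω → ℝ) (l : List (SymmL2 τ × SymmL2 τ)) (ω : Ω) : ℝ :=
  (l.map fun q => W q.1 ω * W q.2 ω - pairing q.1 q.2).sum

/-- The random variable `X` is (a version of) the double stochastic integral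
`∫∫ f(x, y) W(dx) W(dy)`: the extension of `elemIntegral` by `L²`-continuity. -/
structure IsDoubleIntegral {Ω : Type*} [MeasurableSpace Ω] (P : Measure Ω)
    {E : Type*} [MeasureSpace E] {τ : E → E}
    (W : SymmL2 τ → Ω → ℝ) (f : E × E → ℂ) (X : Ω → ℝ) : Prop where
  memLp_kernel : MemLp f 2 ((volume : Measure E).prod volume)
  measurable : Measurable X
  memLp : MemLp X 2 P
  approx : ∃ l : ℕ → List (SymmL2 τ × SymmL2 τ),
    Tendsto (fun n => eLpNorm (fun p => f p - elemKernel (l n) p) 2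
      ((volume : Measure E).prod volume)) atTop (𝓝 0) ∧
    Tendsto (fun n => eLpNorm (fun ω => X ω - elemIntegral W (l n) ω) 2 P) atTop (𝓝 0)

/-- The kernel `∫₀ᵗ (s - y₁)_+^{-(1-H/2)} (s - y₂)_+^{-(1-H/2)} ds`.
(`0` to a negative power is `0` here, so that `x_+^{-(1-H/2)} = 0` for `x ≤ 0`.) -/
noncomputable def rosenblattKernel (H t : ℝ) (y : ℝ × ℝ) : ℝ :=
  ∫ s in (0 : ℝ)..t, (max 0 (s - y.1)) ^ (-(1 - H / 2)) * (max 0 (s - y.2)) ^ (-(1 - H / 2))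

/-- A one dimensional Rosenblatt process of index `H ∈ (1/2, 1)`: for some constant `c > 0` and
some one dimensional real valued white noise `B(dy)` on the line,
`Z(t) = c ∫∫ {∫₀ᵗ (s - y₁)_+^{-(1-H/2)} (s - y₂)_+^{-(1-H/2)} ds} B(dy₁) B(dy₂)` for `t ≥ 0`. -/
def IsRosenblatt {Ω : Type*} [MeasurableSpace Ω] (P : Measure Ω) (H : ℝ)
    (Z : ℝ≥0 → Ω → ℝ) : Prop :=
  1 / 2 < H ∧ H < 1 ∧ ∃ c : ℝ, 0 < c ∧
    ∃ B : Unit → SymmL2 (id : ℝ → ℝ) → Ω → ℝ, IsWhiteNoise P id B ∧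
      ∀ t : ℝ≥0, IsDoubleIntegral P (B ())
        (fun y => ((c * rosenblattKernel H t y : ℝ) : ℂ)) (Z t)

/-- A `d`-dimensional Rosenblatt process of index `H`: its components are independent
one dimensional Rosenblatt processes of index `H`. -/
def IsRosenblattVector {Ω : Type*} [MeasurableSpace Ω] (P : Measure Ω) (H : ℝ) {d : ℕ}
    (Z : Fin d → ℝ≥0 → Ω → ℝ) : Prop :=
  iIndepFun (fun j ω t => Z j t ω) P ∧ ∀ j, IsRosenblatt P H (Z j)

/-- The involution `(s, k) ↦ (s, -k)` of `ℝ × ℝᵈ`. -/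
def flipK (d : ℕ) (p : ℝ × EuclideanSpace ℝ (Fin d)) : ℝ × EuclideanSpace ℝ (Fin d) :=
  (p.1, -p.2)

/-- `E_∞(s, s', k, k') = a₀ r₀ (1 / (|k| |k'|))^{(α+d-1)/2-β}
exp(-(r₀/2) (|k|^{2β} |s| + |k'|^{2β} |s'|))`. -/
noncomputable def Einf (a₀ r₀ α β : ℝ) {d : ℕ} (s s' : ℝ) (k k' : EuclideanSpace ℝ (Fin d)) : ℝ :=
  a₀ * r₀ * (1 / (‖k‖ * ‖k'‖)) ^ ((α + d - 1) / 2 - β) *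
    Real.exp (-(r₀ / 2) * (‖k‖ ^ (2 * β) * |s| + ‖k'‖ ^ (2 * β) * |s'|))

/-- The kernel `∫₀ᵗ 1_{(-∞,σ]²}(s, s') E_∞(σ - s, σ - s', k, k') dσ`. -/
noncomputable def zKernel (a₀ r₀ α β : ℝ) {d : ℕ} (t : ℝ)
    (p : (ℝ × EuclideanSpace ℝ (Fin d)) × (ℝ × EuclideanSpace ℝ (Fin d))) : ℝ :=
  ∫ σ in (0 : ℝ)..t,
    if p.1.1 ≤ σ ∧ p.2.1 ≤ σ then Einf a₀ r₀ α β (σ - p.1.1) (σ - p.2.1) p.1.2 p.2.2 else 0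

/-- The random variable `X` is (a version of)
`∫₀ᵗ dσ ∫_{(-∞,σ]²} ∫_{ℝ^{2d}} E_∞(σ - s, σ - s', k, k') W(ds, dk) W(ds', dk')`, that is, the double
stochastic integral of the time-integrated kernel. -/
def IsZ {Ω : Type*} [MeasurableSpace Ω] (P : Measure Ω) (a₀ r₀ α β : ℝ) {d : ℕ}
    (W : SymmL2 (flipK d) → Ω → ℝ) (t : ℝ≥0) (X : Ω → ℝ) : Prop :=
  IsDoubleIntegral P W (fun p => ((zKernel a₀ r₀ α β (t : ℝ) p : ℝ) : ℂ)) X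

/-- The exponent `δ = β / (α + 2β - 1)`. -/
noncomputable def scalingExponent (α β : ℝ) : ℝ := β / (α + 2 * β - 1)

/-- The index `H = 1 / (2δ)`. -/
noncomputable def hurstIndex (α β : ℝ) : ℝ := 1 / (2 * scalingExponent α β)

end ChaosProcess

/-! Both kernels have the form `∫₀ᵗ g_σ ⊗ g_σ dσ`. For `Z_j` the family is `heatFamily`, the square
root of `E_∞`; for the Rosenblatt process it is `rosFamily`, that is `(σ - y)_+^{-(1-H/2)}`. Each
family has a Gram kernel `⟨g_σ, g_τ⟩ = C |σ - τ|^(H-1)` off the diagonal (`hasPowerGram_heatFamily`,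
`hasPowerGram_rosFamily`). After a rescaling of one family the constants agree, and two families
with equal Gram kernels differ only by an isometry. The power is square integrable on bounded
squares exactly because `H > 1/2`, and this makes the kernels square integrable.

On the diagonal the Gram kernel is infinite, so `g_σ` itself is not in `L²`; only the averages `∫_S
g_σ dσ` are. The kernel is therefore approximated by `(n/t) ∑ᵢ (∫_{cell i} g) ⊗ (∫_{cell i} g)`, a
finite sum of tensors, and `tendsto_lintegral_diagKernel_sub_cellKernel` gives `L²` convergence
using the Gram kernel alone. The second moment bound `integral_sum_wick_sq_le`, a consequence of
Isserlis' formula, carries this convergence over to the stochastic integrals; hence existence,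
uniqueness, and freedom to choose the approximating lists.

The noise `B` must live on the given probability space, so `B φ = W_j (U φ)` for an isometry `U` of
`L²(ℝ)` into `L²_(s)` taking averages of the Rosenblatt family to averages of the heat family
(`exists_isometry_symmL2`). On the closed span of the averages `U` is forced, with values in the
real functions even in `k`. The orthogonal complement is sent to `i` times real functions odd in
`k`: these also lie in `L²_(s)`, are orthogonal to the even ones, and leave room for a copy of
`L²(ℝ)`. With this `B`, the cell approximations of the two double integrals agree almost surely
(`exists_isWhiteNoise_isDoubleIntegral`).

Independence holds because uncorrelated components of a Gaussian process are independent and each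
`Z_j` is, up to null sets, a measurable functional of `W_j` (`iIndepFun_doubleIntegral`). -/

namespace ChaosProcess

/-! ### Isserlis' formula and covariances of Wick products. -/

section GaussianMoments

lemma hasDerivAt_mul_exp_sq (v : ℝ) {p : ℝ → ℝ} {p' t : ℝ} (hp : HasDerivAt p p' t) :
    HasDerivAt (fun t => p t * Real.exp (v * t ^ 2 / 2))
      ((p' + v * t * p t) * Real.exp (v * t ^ 2 / 2)) t := by
  have h2 : HasDerivAt (fun t : ℝ => v * t ^ 2 / 2) (v * t) t := by
    have := ((hasDerivAt_pow 2 t).const_mul v).div_const 2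
    refine this.congr_deriv ?_
    push_cast; ring
  exact (hp.mul h2.exp).congr_deriv (by ring)

/-- The function is the moment generating function of a centered Gaussian of variance `v`, so this
derivative is its fourth moment. -/
lemma iteratedDeriv_four_exp_sq (v : ℝ) :
    iteratedDeriv 4 (fun t : ℝ => Real.exp (v * t ^ 2 / 2)) 0 = 3 * v ^ 2 := by
  have e1 : deriv (fun t : ℝ => Real.exp (v * t ^ 2 / 2))
      = fun t => (v * t) * Real.exp (v * t ^ 2 / 2) := by
    ext t
    have := (hasDerivAt_mul_exp_sq v (hasDerivAt_const t (1 : ℝ))).deriv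
    simpa using this
  have e2 : deriv (fun t : ℝ => (v * t) * Real.exp (v * t ^ 2 / 2))
      = fun t => (v + v ^ 2 * t ^ 2) * Real.exp (v * t ^ 2 / 2) := by
    ext t
    refine (hasDerivAt_mul_exp_sq v ((hasDerivAt_id t).const_mul v)).deriv.trans ?_
    simp only [id]; ring
  have e3 : deriv (fun t : ℝ => (v + v ^ 2 * t ^ 2) * Real.exp (v * t ^ 2 / 2))
      = fun t => (3 * v ^ 2 * t + v ^ 3 * t ^ 3) * Real.exp (v * t ^ 2 / 2) := by
    ext t
    rw [(hasDerivAt_mul_exp_sq v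
      (((hasDerivAt_pow 2 t).const_mul (v ^ 2)).const_add v)).deriv]
    push_cast; ring
  have e4 : deriv (fun t : ℝ => (3 * v ^ 2 * t + v ^ 3 * t ^ 3) * Real.exp (v * t ^ 2 / 2)) 0
      = 3 * v ^ 2 := by
    refine (hasDerivAt_mul_exp_sq v (((hasDerivAt_id (0 : ℝ)).const_mul (3 * v ^ 2)).add
      ((hasDerivAt_pow 3 (0 : ℝ)).const_mul (v ^ 3)))).deriv.trans ?_
    simp
  rw [iteratedDeriv_succ', iteratedDeriv_succ', iteratedDeriv_succ', iteratedDeriv_one, e1, e2, e3,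
    e4]

variable {Ω : Type*} [MeasurableSpace Ω] {P : Measure Ω}

/-- The fourth moment of a centered real Gaussian variable. -/
lemma integral_pow_four_of_hasGaussianLaw {X : Ω → ℝ} (hX : HasGaussianLaw X P)
    (h0 : ∫ ω, X ω ∂P = 0) : ∫ ω, X ω ^ 4 ∂P = 3 * (∫ ω, X ω ^ 2 ∂P) ^ 2 := by
  have hlaw := hX.map_eq_gaussianReal
  rw [h0] at hlaw
  have hv : ((Var[X; P].toNNReal : ℝ≥0) : ℝ) = ∫ ω, X ω ^ 2 ∂P := by
    rw [Real.coe_toNNReal _ (variance_nonneg _ _), variance_of_integral_eq_zero hX.aemeasurable h0]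
  have hset : integrableExpSet X P = Set.univ := by
    have hG : integrableExpSet id (Measure.map X P) = Set.univ := by
      rw [hlaw]; exact integrableExpSet_id_gaussianReal
    ext t
    have ht : t ∈ integrableExpSet id (Measure.map X P) := by rw [hG]; trivial
    simp only [Set.mem_univ, iff_true]
    exact ht.comp_aemeasurable hX.aemeasurable
  have hm : mgf X P = fun t => Real.exp ((Var[X; P].toNNReal : ℝ) * t ^ 2 / 2) := by
    ext t; rw [mgf_gaussianReal hlaw]; simp
  have := iteratedDeriv_mgf_zero (X := X) (μ := P) (by rw [hset]; simp) 4
  rw [hm, iteratedDeriv_four_exp_sq, hv] at this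
  simpa using this.symm

/-- A linear combination of four variables of a Gaussian process is Gaussian. -/
lemma hasGaussianLaw_linComb_four {T : Type*} {X : T → Ω → ℝ} (hX : IsGaussianProcess X P)
    (a b c d : T) (x y z w : ℝ) :
    HasGaussianLaw (fun ω => x * X a ω + y * X b ω + z * X c ω + w * X d ω) P := by
  classical
  have : IsGaussianProcess
      (fun (_ : Unit) ω => x * X a ω + y * X b ω + z * X c ω + w * X d ω) P := by
    refine hX.of_isGaussianProcess fun _ => ⟨{a, b, c, d},
      x • .proj ⟨a, by simp⟩ + y • .proj ⟨b, by simp⟩ + z • .proj ⟨c, by simp⟩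
        + w • .proj ⟨d, by simp⟩, fun ω => ?_⟩
    simp
  exact this.hasGaussianLaw_eval ()

variable {T : Type*} {X : T → Ω → ℝ} (hX : IsGaussianProcess X P)
include hX

lemma integrable_mul_of_isGaussianProcess (a b : T) :
    Integrable (fun ω => X a ω * X b ω) P :=
  ((hX.hasGaussianLaw_eval a).memLp (p := 2) (by simp)).integrable_mul
    ((hX.hasGaussianLaw_eval b).memLp (p := 2) (by simp))

lemma memLp_mul_of_isGaussianProcess (a b : T) : MemLp (fun ω => X a ω * X b ω) 2 P := by
  have : ENNReal.HolderTriple 4 4 2 := ⟨by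
    rw [← two_mul, show (4 : ℝ≥0∞) = 2 * 2 by norm_num,
      ENNReal.mul_inv (by simp) (by simp), ← mul_assoc, ENNReal.mul_inv_cancel (by simp) (by simp),
      one_mul]⟩
  exact ((hX.hasGaussianLaw_eval b).memLp (p := 4) (by simp)).mul'
    ((hX.hasGaussianLaw_eval a).memLp (p := 4) (by simp))

/-- Isserlis' formula for four variables of a centered Gaussian process. -/
lemma integral_mul_four (h0 : ∀ t, ∫ ω, X t ω ∂P = 0) (a b c d : T) :
    ∫ ω, X a ω * X b ω * (X c ω * X d ω) ∂P =
      (∫ ω, X a ω * X b ω ∂P) * (∫ ω, X c ω * X d ω ∂P)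
      + (∫ ω, X a ω * X c ω ∂P) * (∫ ω, X b ω * X d ω ∂P)
      + (∫ ω, X a ω * X d ω ∂P) * (∫ ω, X b ω * X c ω ∂P) := by
  have := hX.isProbabilityMeasure
  have hint : ∀ t, Integrable (X t) P := fun t =>
    ((hX.hasGaussianLaw_eval t).memLp (p := 1) (by simp)).integrable le_rfl
  have hmul := integrable_mul_of_isGaussianProcess hX
  set L : ℝ → ℝ → ℝ → Ω → ℝ := fun y z w ω =>
    1 * X a ω + y * X b ω + z * X c ω + w * X d ω with hL
  have hLg : ∀ y z w, HasGaussianLaw (L y z w) P := fun y z w =>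
    hasGaussianLaw_linComb_four hX a b c d 1 y z w
  have hL0 : ∀ y z w, ∫ ω, L y z w ω ∂P = 0 := fun y z w => by
    simp only [hL]
    rw [integral_add (by fun_prop) (by fun_prop), integral_add (by fun_prop) (by fun_prop),
      integral_add (by fun_prop) (by fun_prop)]
    simp [integral_const_mul, h0]
  have hI4 : ∀ y z w, Integrable (fun ω => L y z w ω ^ 4) P := fun y z w => by
    have h := (((hLg y z w).memLp (p := (4 : ℕ)) (by simp))).integrable_norm_pow (by norm_num)
    refine h.congr (ae_of_all _ fun ω => ?_)
    simp only [Real.norm_eq_abs]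
    exact (show Even 4 by decide).pow_abs _
  have hL2 : ∀ y z w, ∫ ω, L y z w ω ^ 2 ∂P =
      (∫ ω, X a ω * X a ω ∂P) + y ^ 2 * (∫ ω, X b ω * X b ω ∂P)
      + z ^ 2 * (∫ ω, X c ω * X c ω ∂P) + w ^ 2 * (∫ ω, X d ω * X d ω ∂P)
      + 2 * y * (∫ ω, X a ω * X b ω ∂P) + 2 * z * (∫ ω, X a ω * X c ω ∂P)
      + 2 * w * (∫ ω, X a ω * X d ω ∂P) + 2 * y * z * (∫ ω, X b ω * X c ω ∂P)
      + 2 * y * w * (∫ ω, X b ω * X d ω ∂P) + 2 * z * w * (∫ ω, X c ω * X d ω ∂P) := by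
    intro y z w
    have e : (fun ω => L y z w ω ^ 2) = fun ω =>
        (X a ω * X a ω) + y ^ 2 * (X b ω * X b ω)
      + z ^ 2 * (X c ω * X c ω) + w ^ 2 * (X d ω * X d ω)
      + 2 * y * (X a ω * X b ω) + 2 * z * (X a ω * X c ω)
      + 2 * w * (X a ω * X d ω) + 2 * y * z * (X b ω * X c ω)
      + 2 * y * w * (X b ω * X d ω) + 2 * z * w * (X c ω * X d ω) := by
      ext ω; simp only [hL]; ring
    rw [e]
    have hm := fun (r : ℝ) s t => (hmul s t).const_mul r
    rw [integral_add, integral_add, integral_add, integral_add, integral_add, integral_add,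
      integral_add, integral_add, integral_add]
    · simp only [integral_const_mul]
    all_goals
      first
        | exact hm _ _ _
        | (repeat' first | exact hmul _ _ | exact hm _ _ _ | refine Integrable.add ?_ ?_)
  have hL4 := fun y z w => integral_pow_four_of_hasGaussianLaw (hLg y z w) (hL0 y z w)
  -- Polarization: summing `ε₁ε₂ε₃ (a + ε₁b + ε₂c + ε₃d)⁴` over the eight sign choices leaves only
  -- the `abcd` term, with coefficient `8 · 4! = 192`.
  have key : (fun ω => X a ω * X b ω * (X c ω * X d ω)) = fun ω => (1 / 192) *
      (L 1 1 1 ω ^ 4 + L 1 (-1) (-1) ω ^ 4 + L (-1) 1 (-1) ω ^ 4 + L (-1) (-1) 1 ω ^ 4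
        - L (-1) 1 1 ω ^ 4 - L 1 (-1) 1 ω ^ 4 - L 1 1 (-1) ω ^ 4 - L (-1) (-1) (-1) ω ^ 4) := by
    ext ω; simp only [hL]; ring
  rw [key, integral_const_mul, integral_sub, integral_sub, integral_sub, integral_sub, integral_add,
    integral_add, integral_add]
  · simp only [hL4, hL2]; ring
  all_goals
    repeat' first
      | exact hI4 _ _ _
      | refine Integrable.sub ?_ ?_
      | refine Integrable.add ?_ ?_

/-- The covariance of two Wick products of variables of a centered Gaussian process. -/
lemma integral_wick_mul_wick [IsProbabilityMeasure P] (h0 : ∀ t, ∫ ω, X t ω ∂P = 0) (a b c d : T) :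
    ∫ ω, (X a ω * X b ω - ∫ ω, X a ω * X b ω ∂P) * (X c ω * X d ω - ∫ ω, X c ω * X d ω ∂P) ∂P =
      (∫ ω, X a ω * X c ω ∂P) * (∫ ω, X b ω * X d ω ∂P)
      + (∫ ω, X a ω * X d ω ∂P) * (∫ ω, X b ω * X c ω ∂P) := by
  have hmul := integrable_mul_of_isGaussianProcess hX
  have h4 : Integrable (fun ω => X a ω * X b ω * (X c ω * X d ω)) P :=
    (memLp_mul_of_isGaussianProcess hX a b).integrable_mul (memLp_mul_of_isGaussianProcess hX c d)
  have h := integral_mul_four hX h0 a b c d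
  set p := ∫ ω, X a ω * X b ω ∂P with hp
  set q := ∫ ω, X c ω * X d ω ∂P with hq
  have e : (fun ω => (X a ω * X b ω - p) * (X c ω * X d ω - q)) = fun ω =>
      X a ω * X b ω * (X c ω * X d ω) - q * (X a ω * X b ω) - p * (X c ω * X d ω) + p * q := by
    ext ω; ring
  rw [e, integral_add, integral_sub, integral_sub, integral_const_mul, integral_const_mul, ← hp,
    ← hq, h]
  · simp; ring
  all_goals
    repeat' first
      | exact h4
      | exact (hmul _ _).const_mul _
      | exact integrable_const _
      | refine Integrable.sub ?_ ?_

end GaussianMoments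

/-! ### The scalar product of `L²_(s)` and elementary tensors. -/

section Pairing

variable {E : Type*} [MeasureSpace E] {τ : E → E}

lemma SymmL2.memLp (φ : SymmL2 τ) : MemLp φ.1 2 (volume : Measure E) := φ.2.1

lemma SymmL2.conj_ae (φ : SymmL2 τ) :
    ∀ᵐ x ∂(volume : Measure E), (starRingEnd ℂ) (φ.1 x) = φ.1 (τ x) := φ.2.2

lemma integral_comp_involution (hτ : MeasurePreserving τ (volume : Measure E) volume)
    (hinv : Function.Involutive τ) (f : E → ℂ) : ∫ x, f (τ x) = ∫ x, f x :=
  hτ.integral_comp (MeasurableEquiv.ofInvolutive τ hinv hτ.measurable).measurableEmbedding f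

/-- Conjugating the integrand amounts to substituting `τ x` for `x`, so the integral is real and the
real part taken in `pairing` loses nothing. -/
lemma integral_mul_comp_eq_pairing (hτ : MeasurePreserving τ (volume : Measure E) volume)
    (hinv : Function.Involutive τ) (φ ψ : SymmL2 τ) :
    ∫ x, φ.1 x * ψ.1 (τ x) = (pairing φ ψ : ℂ) := by
  have h : (starRingEnd ℂ) (∫ x, φ.1 x * ψ.1 (τ x)) = ∫ x, φ.1 x * ψ.1 (τ x) := by
    rw [← integral_conj, ← integral_comp_involution hτ hinv (fun x => φ.1 x * ψ.1 (τ x))]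
    refine integral_congr_ae ?_
    filter_upwards [φ.conj_ae, ψ.conj_ae] with x h1 h2
    simp only [map_mul, h1, hinv x, ← h2, Complex.conj_conj]
  rw [pairing]
  exact (Complex.conj_eq_iff_re.mp h).symm

lemma pairing_comm (hτ : MeasurePreserving τ (volume : Measure E) volume)
    (hinv : Function.Involutive τ) (φ ψ : SymmL2 τ) : pairing φ ψ = pairing ψ φ := by
  have h := integral_comp_involution hτ hinv (fun x => φ.1 x * ψ.1 (τ x))
  simp only [hinv _] at h
  rw [pairing, pairing, ← h]
  simp only [mul_comm]

lemma integral_conj_mul_eq_pairing (hτ : MeasurePreserving τ (volume : Measure E) volume)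
    (hinv : Function.Involutive τ) (φ ψ : SymmL2 τ) :
    ∫ x, (starRingEnd ℂ) (φ.1 x) * ψ.1 x = (pairing φ ψ : ℂ) := by
  rw [pairing_comm hτ hinv, ← integral_mul_comp_eq_pairing hτ hinv]
  refine integral_congr_ae ?_
  filter_upwards [φ.conj_ae] with x hx
  rw [hx, mul_comm]

lemma memLp_tensor (φ ψ : SymmL2 τ) :
    MemLp (fun p : E × E => φ.1 p.1 * ψ.1 p.2) 2 ((volume : Measure E).prod volume) := by
  have h1 := φ.memLp.integrable_norm_pow (p := 2) two_ne_zero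
  have h2 := ψ.memLp.integrable_norm_pow (p := 2) two_ne_zero
  have hm : AEStronglyMeasurable (fun p : E × E => φ.1 p.1 * ψ.1 p.2)
      ((volume : Measure E).prod volume) :=
    φ.memLp.1.comp_fst.mul ψ.memLp.1.comp_snd
  refine (memLp_two_iff_integrable_sq_norm hm).2 ?_
  simpa only [norm_mul, mul_pow] using h1.mul_prod h2

/-- The elementary tensor `φ ⊗ ψ` as an element of `L²`. -/
noncomputable def tensorLp (φ ψ : SymmL2 τ) : Lp ℂ 2 ((volume : Measure E).prod (volume : Measure E)) :=
  (memLp_tensor φ ψ).toLp _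

lemma coeFn_tensorLp (φ ψ : SymmL2 τ) :
    tensorLp φ ψ =ᵐ[(volume : Measure E).prod volume] fun p => φ.1 p.1 * ψ.1 p.2 :=
  (memLp_tensor φ ψ).coeFn_toLp

variable [SFinite (volume : Measure E)]

/-- The inner product of two elementary tensors. -/
lemma inner_toLp_tensor (hτ : MeasurePreserving τ (volume : Measure E) volume)
    (hinv : Function.Involutive τ) (φ ψ φ' ψ' : SymmL2 τ) :
    inner ℂ (tensorLp φ ψ) (tensorLp φ' ψ')
      = ((pairing φ φ' * pairing ψ ψ' : ℝ) : ℂ) := by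
  rw [L2.inner_def]
  have : ∀ᵐ p ∂((volume : Measure E).prod volume),
      inner ℂ ((tensorLp φ ψ) p) ((tensorLp φ' ψ') p)
      = ((starRingEnd ℂ) (φ.1 p.1) * φ'.1 p.1) * ((starRingEnd ℂ) (ψ.1 p.2) * ψ'.1 p.2) := by
    filter_upwards [coeFn_tensorLp φ ψ, coeFn_tensorLp φ' ψ'] with p h1 h2
    rw [h1, h2, RCLike.inner_apply, map_mul]
    ring
  rw [integral_congr_ae this, integral_prod_mul
    (fun x => (starRingEnd ℂ) (φ.1 x) * φ'.1 x) (fun x => (starRingEnd ℂ) (ψ.1 x) * ψ'.1 x),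
    integral_conj_mul_eq_pairing hτ hinv, integral_conj_mul_eq_pairing hτ hinv]
  push_cast; rfl

lemma norm_sq_sum_tensor (hτ : MeasurePreserving τ (volume : Measure E) volume)
    (hinv : Function.Involutive τ) {ι : Type*} (s : Finset ι) (c : ι → ℝ) (φ ψ : ι → SymmL2 τ) :
    ‖∑ i ∈ s, (c i : ℂ) • (tensorLp (φ i) (ψ i))‖ ^ 2
      = ∑ i ∈ s, ∑ j ∈ s, c i * c j * (pairing (φ i) (φ j) * pairing (ψ i) (ψ j)) := by
  rw [← inner_self_eq_norm_sq (𝕜 := ℂ), sum_inner, map_sum]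
  refine Finset.sum_congr rfl fun i _ => ?_
  rw [inner_sum, map_sum]
  refine Finset.sum_congr rfl fun j _ => ?_
  rw [inner_smul_left, inner_smul_right, inner_toLp_tensor hτ hinv, Complex.conj_ofReal,
    ← Complex.ofReal_mul, ← Complex.ofReal_mul]
  simp only [RCLike.re_eq_complex_re, Complex.ofReal_re]
  ring

/-- The left side is the inner product of the kernel with its transpose. Transposition preserves the
norm, so Cauchy–Schwarz applies; the kernel need not be symmetric. -/
lemma sum_pairing_swap_le (hτ : MeasurePreserving τ (volume : Measure E) volume)
    (hinv : Function.Involutive τ) {ι : Type*} (s : Finset ι) (c : ι → ℝ) (φ ψ : ι → SymmL2 τ) :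
    ∑ i ∈ s, ∑ j ∈ s, c i * c j * (pairing (φ i) (ψ j) * pairing (ψ i) (φ j))
      ≤ ‖∑ i ∈ s, (c i : ℂ) • (tensorLp (φ i) (ψ i))‖ ^ 2 := by
  set K := ∑ i ∈ s, (c i : ℂ) • (tensorLp (φ i) (ψ i))
  set K' := ∑ i ∈ s, (c i : ℂ) • (tensorLp (ψ i) (φ i))
  have hn : ‖K'‖ ^ 2 = ‖K‖ ^ 2 := by
    rw [norm_sq_sum_tensor hτ hinv, norm_sq_sum_tensor hτ hinv]
    simp only [mul_comm (pairing (ψ _) (ψ _))]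
  have hn' : ‖K'‖ = ‖K‖ := by
    rwa [sq_eq_sq₀ (norm_nonneg _) (norm_nonneg _)] at hn
  have hi : (inner ℂ K K').re =
      ∑ i ∈ s, ∑ j ∈ s, c i * c j * (pairing (φ i) (ψ j) * pairing (ψ i) (φ j)) := by
    rw [sum_inner, Complex.re_sum]
    refine Finset.sum_congr rfl fun i _ => ?_
    rw [inner_sum, Complex.re_sum]
    refine Finset.sum_congr rfl fun j _ => ?_
    rw [inner_smul_left, inner_smul_right, inner_toLp_tensor hτ hinv, Complex.conj_ofReal,
      ← Complex.ofReal_mul, ← Complex.ofReal_mul, Complex.ofReal_re]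
    ring
  rw [← hi]
  calc (inner ℂ K K').re ≤ ‖K‖ * ‖K'‖ := re_inner_le_norm (𝕜 := ℂ) K K'
    _ = ‖K‖ ^ 2 := by rw [hn', sq]

end Pairing

/-! ### The second moment bound for elementary double integrals. -/

section DoubleIntegral

variable {Ω : Type*} [MeasurableSpace Ω] {P : Measure Ω} [IsProbabilityMeasure P]
  {E : Type*} [MeasureSpace E] {τ : E → E} {ι : Type*} [DecidableEq ι]
  {W : ι → SymmL2 τ → Ω → ℝ}

lemma memLp_elemIntegral (hW : IsWhiteNoise P τ W) (j : ι) (l : List (SymmL2 τ × SymmL2 τ)) :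
    MemLp (elemIntegral (W j) l) 2 P := by
  have e : elemIntegral (W j) l = fun ω => ∑ i : Fin l.length,
      (W j l[i].1 ω * W j l[i].2 ω - pairing l[i].1 l[i].2) := by
    ext ω
    rw [elemIntegral, ← Fin.sum_univ_fun_getElem]; rfl
  rw [e]
  refine memLp_finsetSum _ fun i _ => ?_
  exact (memLp_mul_of_isGaussianProcess hW.gaussian (j, l[i].1) (j, l[i].2)).sub
    (memLp_const _)

lemma memLp_elemKernel (l : List (SymmL2 τ × SymmL2 τ)) :
    MemLp (elemKernel l) 2 ((volume : Measure E).prod volume) := by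
  have e : elemKernel l = fun p => ∑ i : Fin l.length, (l[i].1.1 p.1 * l[i].2.1 p.2) := by
    ext ω
    rw [elemKernel, ← Fin.sum_univ_fun_getElem]; rfl
  rw [e]
  exact memLp_finsetSum _ fun i _ => memLp_tensor _ _

variable [SFinite (volume : Measure E)]
  (hτ : MeasurePreserving τ (volume : Measure E) volume) (hinv : Function.Involutive τ)
  (hW : IsWhiteNoise P τ W)
include hτ hinv hW

/-- By Isserlis' formula the second moment is the squared norm of the kernel plus its inner product
with the transposed kernel, and the latter is at most the former. -/
lemma integral_sum_wick_sq_le (j : ι) {κ : Type*} (s : Finset κ) (c : κ → ℝ) (φ ψ : κ → SymmL2 τ) :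
    ∫ ω, (∑ i ∈ s, c i * (W j (φ i) ω * W j (ψ i) ω - pairing (φ i) (ψ i))) ^ 2 ∂P
      ≤ 2 * ‖∑ i ∈ s, (c i : ℂ) • (tensorLp (φ i) (ψ i))‖ ^ 2 := by
  have hcov : ∀ φ ψ, ∫ ω, W j φ ω * W j ψ ω ∂P = pairing φ ψ := fun φ ψ => by
    rw [hW.cov, if_pos rfl]
  have hwick : ∀ i, MemLp (fun ω => W j (φ i) ω * W j (ψ i) ω - pairing (φ i) (ψ i)) 2 P :=
    fun i => (memLp_mul_of_isGaussianProcess hW.gaussian (j, φ i) (j, ψ i)).sub (memLp_const _)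
  have e : ∀ ω, (∑ i ∈ s, c i * (W j (φ i) ω * W j (ψ i) ω - pairing (φ i) (ψ i))) ^ 2 =
      ∑ i ∈ s, ∑ k ∈ s, c i * c k * ((W j (φ i) ω * W j (ψ i) ω - pairing (φ i) (ψ i)) *
        (W j (φ k) ω * W j (ψ k) ω - pairing (φ k) (ψ k))) := fun ω => by
    rw [sq, Finset.sum_mul_sum]
    refine Finset.sum_congr rfl fun i _ => Finset.sum_congr rfl fun k _ => ?_
    ring
  have hint : ∀ i k, Integrable (fun ω => c i * c k *
      ((W j (φ i) ω * W j (ψ i) ω - pairing (φ i) (ψ i)) *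
        (W j (φ k) ω * W j (ψ k) ω - pairing (φ k) (ψ k)))) P := fun i k =>
    ((hwick i).integrable_mul (hwick k)).const_mul _
  have hwk : ∀ i k, ∫ ω, (W j (φ i) ω * W j (ψ i) ω - pairing (φ i) (ψ i)) *
        (W j (φ k) ω * W j (ψ k) ω - pairing (φ k) (ψ k)) ∂P =
      pairing (φ i) (φ k) * pairing (ψ i) (ψ k) + pairing (φ i) (ψ k) * pairing (ψ i) (φ k) := by
    intro i k
    have := integral_wick_mul_wick hW.gaussian (fun q => hW.mean q.1 q.2)
      (j, φ i) (j, ψ i) (j, φ k) (j, ψ k)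
    simpa only [hcov] using this
  simp_rw [e]
  rw [integral_finsetSum _ fun i _ => integrable_finsetSum _ fun k _ => hint i k]
  simp_rw [integral_finsetSum s fun k _ => hint _ k, integral_const_mul, hwk, mul_add,
    Finset.sum_add_distrib]
  rw [← norm_sq_sum_tensor hτ hinv, two_mul]
  gcongr
  exact sum_pairing_swap_le hτ hinv s c φ ψ

/-- The double stochastic integral is `L²`-Lipschitz on elementary kernels. -/
lemma eLpNorm_elemIntegral_sub_le (j : ι) (l l' : List (SymmL2 τ × SymmL2 τ)) :
    eLpNorm (fun ω => elemIntegral (W j) l ω - elemIntegral (W j) l' ω) 2 P ≤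
      2 * eLpNorm (fun p => elemKernel l p - elemKernel l' p) 2
        ((volume : Measure E).prod volume) := by
  -- The difference of the two lists is treated as a single sum with signs `±1`. The signs stay
  -- outside the noise, as linearity of `W j` is not part of its definition.
  let q : Fin l.length ⊕ Fin l'.length → SymmL2 τ × SymmL2 τ :=
    Sum.elim (fun i => l[i]) (fun i => l'[i])
  let c : Fin l.length ⊕ Fin l'.length → ℝ := Sum.elim (fun _ => 1) (fun _ => -1)
  have hI : ∀ ω, elemIntegral (W j) l ω - elemIntegral (W j) l' ω =
      ∑ i, c i * (W j (q i).1 ω * W j (q i).2 ω - pairing (q i).1 (q i).2) := fun ω => by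
    rw [Fintype.sum_sum_type, elemIntegral, elemIntegral, ← Fin.sum_univ_fun_getElem,
      ← Fin.sum_univ_fun_getElem]
    simp only [q, c, Sum.elim_inl, Sum.elim_inr, one_mul, neg_mul, Finset.sum_neg_distrib,
      sub_eq_add_neg]
    rfl
  have hK : ∀ p, elemKernel l p - elemKernel l' p =
      ∑ i, (c i : ℂ) * ((q i).1.1 p.1 * (q i).2.1 p.2) := fun p => by
    rw [Fintype.sum_sum_type, elemKernel, elemKernel, ← Fin.sum_univ_fun_getElem,
      ← Fin.sum_univ_fun_getElem]
    simp only [q, c, Sum.elim_inl, Sum.elim_inr, Complex.ofReal_one, Complex.ofReal_neg, one_mul,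
      neg_mul, Finset.sum_neg_distrib, sub_eq_add_neg]
    rfl
  have hmI := (memLp_elemIntegral hW j l).sub (memLp_elemIntegral hW j l')
  have hmK := (memLp_elemKernel l).sub (memLp_elemKernel l')
  have hKL : hmK.toLp _ = ∑ i, (c i : ℂ) • (tensorLp (q i).1 (q i).2) := by
    refine Lp.ext ?_
    have h1 : ∀ᵐ p ∂((volume : Measure E).prod volume), ∀ i,
        (tensorLp (q i).1 (q i).2) p = (q i).1.1 p.1 * (q i).2.1 p.2 :=
      ae_all_iff.2 fun i => coeFn_tensorLp (q i).1 (q i).2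
    have h2 : ∀ᵐ p ∂((volume : Measure E).prod volume), ∀ i,
        ((c i : ℂ) • (tensorLp (q i).1 (q i).2)) p =
          (c i : ℂ) • (tensorLp (q i).1 (q i).2) p :=
      ae_all_iff.2 fun i => Lp.coeFn_smul _ _
    filter_upwards [hmK.coeFn_toLp, h1, h2, Lp.coeFn_finsetSum Finset.univ
      (fun i => (c i : ℂ) • (tensorLp (q i).1 (q i).2))] with p h0 h1 h2 h3
    rw [h0, h3, Finset.sum_apply]
    simp only [h2, h1, smul_eq_mul]
    exact hK p
  have hsq : (eLpNorm (fun ω => elemIntegral (W j) l ω - elemIntegral (W j) l' ω) 2 P).toReal ^ 2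
      = ∫ ω, (elemIntegral (W j) l ω - elemIntegral (W j) l' ω) ^ 2 ∂P := by
    have h := hmI.eLpNorm_eq_integral_rpow_norm (by norm_num) (by norm_num)
    have h0 : 0 ≤ ∫ ω, (elemIntegral (W j) l ω - elemIntegral (W j) l' ω) ^ 2 ∂P :=
      integral_nonneg fun _ => sq_nonneg _
    have h' : eLpNorm (fun ω => elemIntegral (W j) l ω - elemIntegral (W j) l' ω) 2 P =
      ENNReal.ofReal (√(∫ ω, (elemIntegral (W j) l ω - elemIntegral (W j) l' ω) ^ 2 ∂P)) := by
      rw [Real.sqrt_eq_rpow]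
      refine h.trans ?_
      simp
    rw [h', ENNReal.toReal_ofReal (Real.sqrt_nonneg _), Real.sq_sqrt h0]
  have hfI : eLpNorm (fun ω => elemIntegral (W j) l ω - elemIntegral (W j) l' ω) 2 P ≠ ∞ := hmI.2.ne
  have hfK : eLpNorm (fun p => elemKernel l p - elemKernel l' p) 2
        ((volume : Measure E).prod volume) ≠ ∞ := hmK.2.ne
  have hN : ‖hmK.toLp _‖ = (eLpNorm (fun p => elemKernel l p - elemKernel l' p) 2
        ((volume : Measure E).prod volume)).toReal := Lp.norm_toLp _ _
  rw [← ENNReal.toReal_le_toReal hfI (ENNReal.mul_ne_top (by norm_num) hfK), ENNReal.toReal_mul,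
    ← hN, hKL]
  refine le_of_sq_le_sq ?_ (by positivity)
  rw [hsq]
  simp_rw [hI]
  refine (integral_sum_wick_sq_le hτ hinv hW j Finset.univ c (fun i => (q i).1)
    (fun i => (q i).2)).trans ?_
  -- The second moment bound yields the constant `√2`; the rounder constant `2` only needs `2 ≤ 2 ^
  -- 2`.
  rw [mul_pow]
  gcongr
  norm_num

end DoubleIntegral
-- Existence, uniqueness and independence of double integrals.
section Approximation

variable {Ω : Type*} [MeasurableSpace Ω] {P : Measure Ω}
  {E : Type*} [MeasureSpace E] {τ : E → E} {ι : Type*} [DecidableEq ι]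
  {W : ι → SymmL2 τ → Ω → ℝ}

/-- The covariance forces `𝔼[(W φ - W ψ)²] = 0`. Needed because `SymmL2` does not identify functions
equal almost everywhere, while the isometry built later is determined only almost everywhere. -/
lemma IsWhiteNoise.ae_eq_of_ae_eq (hW : IsWhiteNoise P τ W)
    (hτ : MeasurePreserving τ (volume : Measure E) volume) (j : ι) {φ ψ : SymmL2 τ}
    (h : φ.1 =ᵐ[volume] ψ.1) : W j φ =ᵐ[P] W j ψ := by
  have hτh : φ.1 ∘ τ =ᵐ[volume] ψ.1 ∘ τ := hτ.quasiMeasurePreserving.ae_eq_comp h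
  have h1 : pairing φ ψ = pairing φ φ := by
    rw [pairing, pairing]; congr 1
    refine integral_congr_ae ?_
    filter_upwards [hτh] with x hx
    simp only [Function.comp_apply] at hx
    rw [hx]
  have h2 : pairing ψ ψ = pairing φ ψ := by
    rw [pairing, pairing]; congr 1
    refine integral_congr_ae ?_
    filter_upwards [h] with x hx
    rw [hx]
  have hm : ∀ a b, Integrable (fun ω => W j a ω * W j b ω) P := fun a b =>
    integrable_mul_of_isGaussianProcess hW.gaussian (j, a) (j, b)
  have hcov : ∀ φ ψ, ∫ ω, W j φ ω * W j ψ ω ∂P = pairing φ ψ := fun φ ψ => by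
    rw [hW.cov, if_pos rfl]
  have e : ∀ ω, (W j φ ω - W j ψ ω) ^ 2 =
      W j φ ω * W j φ ω - 2 * (W j φ ω * W j ψ ω) + W j ψ ω * W j ψ ω := fun ω => by ring
  have h0 : ∫ ω, (W j φ ω - W j ψ ω) ^ 2 ∂P = 0 := by
    simp_rw [e]
    rw [integral_add (by exact (hm _ _).sub ((hm _ _).const_mul _)) (hm _ _),
      integral_sub (hm _ _) ((hm _ _).const_mul _), integral_const_mul, hcov, hcov, hcov, h2, h1]
    ring
  have hint : Integrable (fun ω => (W j φ ω - W j ψ ω) ^ 2) P := by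
    simp_rw [e]
    exact ((hm _ _).sub ((hm _ _).const_mul _)).add (hm _ _)
  rw [integral_eq_zero_iff_of_nonneg (fun _ => sq_nonneg _) hint] at h0
  filter_upwards [h0] with ω hω
  have : W j φ ω - W j ψ ω = 0 := by simpa using hω
  linarith

variable [IsProbabilityMeasure P] [SFinite (volume : Measure E)]
  (hτ : MeasurePreserving τ (volume : Measure E) volume) (hinv : Function.Involutive τ)
  (hW : IsWhiteNoise P τ W)
include hτ hinv hW

lemma eLpNorm_elemIntegral_sub_le_add (j : ι) {f : E × E → ℂ}
    (hf : MemLp f 2 ((volume : Measure E).prod volume)) (l l' : List (SymmL2 τ × SymmL2 τ)) :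
    eLpNorm (fun ω => elemIntegral (W j) l ω - elemIntegral (W j) l' ω) 2 P ≤
      2 * (eLpNorm (fun p => f p - elemKernel l p) 2 ((volume : Measure E).prod volume)
        + eLpNorm (fun p => f p - elemKernel l' p) 2 ((volume : Measure E).prod volume)) := by
  refine (eLpNorm_elemIntegral_sub_le hτ hinv hW j l l').trans ?_
  gcongr
  have e : (fun p => elemKernel l p - elemKernel l' p) =
      (fun p => f p - elemKernel l' p) - (fun p => f p - elemKernel l p) := by
    ext p; simp
  rw [e, add_comm]
  exact eLpNorm_sub_le (hf.sub (memLp_elemKernel l')).1 (hf.sub (memLp_elemKernel l)).1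
    (by norm_num)

/-- A double stochastic integral is the limit along every approximation of its kernel. -/
lemma IsDoubleIntegral.tendsto {j : ι} {f : E × E → ℂ} {X : Ω → ℝ}
    (hX : IsDoubleIntegral P (W j) f X) {l : ℕ → List (SymmL2 τ × SymmL2 τ)}
    (hl : Tendsto (fun n => eLpNorm (fun p => f p - elemKernel (l n) p) 2
      ((volume : Measure E).prod volume)) atTop (𝓝 0)) :
    Tendsto (fun n => eLpNorm (fun ω => X ω - elemIntegral (W j) (l n) ω) 2 P) atTop (𝓝 0) := by
  obtain ⟨l', hl', hX'⟩ := hX.approx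
  have hi := fun l => memLp_elemIntegral hW j l
  have hle : ∀ n, eLpNorm (fun ω => X ω - elemIntegral (W j) (l n) ω) 2 P ≤
      eLpNorm (fun ω => X ω - elemIntegral (W j) (l' n) ω) 2 P +
      2 * (eLpNorm (fun p => f p - elemKernel (l' n) p) 2 ((volume : Measure E).prod volume)
        + eLpNorm (fun p => f p - elemKernel (l n) p) 2 ((volume : Measure E).prod volume)) := by
    intro n
    have e : (fun ω => X ω - elemIntegral (W j) (l n) ω) =
        (fun ω => X ω - elemIntegral (W j) (l' n) ω) +
          (fun ω => elemIntegral (W j) (l' n) ω - elemIntegral (W j) (l n) ω) := by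
      ext ω; simp
    rw [e]
    exact (eLpNorm_add_le (hX.memLp.sub (hi _)).1 ((hi _).sub (hi _)).1 (by norm_num)).trans
      (add_le_add le_rfl
        (eLpNorm_elemIntegral_sub_le_add hτ hinv hW j hX.memLp_kernel (l' n) (l n)))
  refine tendsto_of_tendsto_of_tendsto_of_le_of_le tendsto_const_nhds ?_ (fun _ => zero_le) hle
  have hlim := hX'.add (ENNReal.Tendsto.const_mul (hl'.add hl) (a := 2) (Or.inr (by simp)))
  rwa [add_zero, mul_zero, add_zero] at hlim

lemma IsDoubleIntegral.ae_eq {j : ι} {f : E × E → ℂ} {X X' : Ω → ℝ}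
    (hX : IsDoubleIntegral P (W j) f X) (hX' : IsDoubleIntegral P (W j) f X') : X' =ᵐ[P] X := by
  obtain ⟨l, hl, hl2⟩ := hX.approx
  have hlim := (hX'.tendsto hτ hinv hW hl).add hl2
  simp only [add_zero] at hlim
  have hi := fun l => memLp_elemIntegral hW j l
  have h0 : eLpNorm (X' - X) 2 P ≤ 0 := by
    refine ge_of_tendsto' hlim fun n => ?_
    have e : X' - X = (fun ω => X' ω - elemIntegral (W j) (l n) ω) -
        (fun ω => X ω - elemIntegral (W j) (l n) ω) := by
      ext ω; simp
    rw [e]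
    exact eLpNorm_sub_le (hX'.memLp.sub (hi _)).1 (hX.memLp.sub (hi _)).1 (by norm_num)
  have := (eLpNorm_eq_zero_iff (hX'.memLp.sub hX.memLp).1 (by norm_num)).1 (le_antisymm h0 zero_le)
  filter_upwards [this] with ω hω
  simpa [sub_eq_zero] using hω

lemma exists_isDoubleIntegral (j : ι) {f : E × E → ℂ}
    (hf : MemLp f 2 ((volume : Measure E).prod volume)) {l : ℕ → List (SymmL2 τ × SymmL2 τ)}
    (hl : Tendsto (fun n => eLpNorm (fun p => f p - elemKernel (l n) p) 2
      ((volume : Measure E).prod volume)) atTop (𝓝 0)) :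
    ∃ X, IsDoubleIntegral P (W j) f X := by
  have hi := fun n => memLp_elemIntegral hW j (l n)
  have hc : CauchySeq fun n => (hi n).toLp _ := by
    rw [EMetric.cauchySeq_iff]
    intro ε hε
    -- The Lipschitz constant `2` and two errors give `4 (ε / 5)`; the fifth part makes the
    -- inequality strict.
    have h4 : 0 < ε / 5 := ENNReal.div_pos hε.ne' (by norm_num)
    obtain ⟨N, hN⟩ := (ENNReal.tendsto_atTop_zero.1 hl) (ε / 5) h4
    by_cases htop : ε = ∞
    · exact ⟨0, fun m _ n _ => by rw [htop]; exact edist_lt_top _ _⟩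
    refine ⟨N, fun m hm n hn => ?_⟩
    rw [Lp.edist_toLp_toLp]
    refine (eLpNorm_elemIntegral_sub_le_add hτ hinv hW j hf (l m) (l n)).trans_lt ?_
    refine (mul_le_mul_right (add_le_add (hN m hm) (hN n hn)) 2).trans_lt ?_
    have h5 : ε / 5 ≠ ∞ := ENNReal.div_ne_top htop (by norm_num)
    calc 2 * (ε / 5 + ε / 5) = 4 * (ε / 5) := by ring
      _ < 5 * (ε / 5) := by
        exact (ENNReal.mul_lt_mul_iff_left h4.ne' h5).2 (by norm_num)
      _ = ε := ENNReal.mul_div_cancel (by norm_num) (by norm_num)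
  obtain ⟨Y, hY⟩ := cauchySeq_tendsto_of_complete hc
  -- `IsDoubleIntegral` asks for a measurable variable, so a measurable representative of the limit
  -- is chosen.
  obtain ⟨X, hXm, hXY⟩ := (Lp.aestronglyMeasurable Y).aemeasurable
  have hXL : MemLp X 2 P := (memLp_congr_ae hXY).1 (Lp.memLp Y)
  refine ⟨X, hf, hXm, hXL, l, hl, ?_⟩
  have hYX : Y = hXL.toLp X := by
    refine Lp.ext (hXY.trans hXL.coeFn_toLp.symm)
  rw [hYX, tendsto_iff_edist_tendsto_0] at hY
  refine hY.congr fun n => ?_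
  rw [edist_comm, Lp.edist_toLp_toLp]
  rfl

omit [SFinite (volume : Measure E)] hτ hinv in
/-- Double stochastic integrals with respect to the components of a white noise form independent
families. -/
lemma iIndepFun_doubleIntegral {S : Type*} {f : ι → S → E × E → ℂ} {Z : ι → S → Ω → ℝ}
    (hZ : ∀ j s, IsDoubleIntegral P (W j) (f j s) (Z j s)) :
    iIndepFun (fun j ω s => Z j s ω) P := by
  have hWm : ∀ j φ, AEMeasurable (W j φ) P := fun j φ => hW.gaussian.aemeasurable (j, φ)
  -- The noise is only almost everywhere measurable; composing with measurable functionals below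
  -- requires genuinely measurable versions.
  let V : ι → SymmL2 τ → Ω → ℝ := fun j φ => (hWm j φ).mk
  have hVm : ∀ j φ, Measurable (V j φ) := fun j φ => (hWm j φ).measurable_mk
  have hWV : ∀ j φ, W j φ =ᵐ[P] V j φ := fun j φ => (hWm j φ).ae_eq_mk
  have hVg : IsGaussianProcess (fun (q : (_ : ι) × SymmL2 τ) ω => V q.1 q.2 ω) P :=
    (hW.gaussian.comp_right (fun q : (_ : ι) × SymmL2 τ => (q.1, q.2))).congr
      fun q => hWV q.1 q.2
  have hind : iIndepFun (fun j ω φ => V j φ ω) P := by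
    refine hVg.iIndepFun_of_covariance_eq_zero (fun j φ => (hVm j φ).aemeasurable)
      fun i j hij φ ψ => ?_
    have h0 : ∀ j φ, P[V j φ] = 0 := fun j φ => by
      rw [← hW.mean j φ]; exact integral_congr_ae (hWV j φ).symm
    have h2 : ∀ j φ, MemLp (V j φ) 2 P := fun j φ =>
      (hVg.hasGaussianLaw_eval ⟨j, φ⟩).memLp (by simp)
    rw [covariance_eq_sub (h2 _ _) (h2 _ _), h0, h0, mul_zero, sub_zero]
    have := hW.cov i j φ ψ
    rw [if_neg hij] at this
    rw [← this]
    refine integral_congr_ae ?_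
    filter_upwards [hWV i φ, hWV j ψ] with ω h1 h2
    simp [h1, h2]
  have hae : ∀ j l, elemIntegral (W j) l =ᵐ[P] elemIntegral (V j) l := by
    intro j l
    induction l with
    | nil => exact ae_of_all _ fun ω => rfl
    | cons q l ih =>
      filter_upwards [ih, hWV j q.1, hWV j q.2] with ω h h1 h2
      simp only [elemIntegral, List.map_cons, List.sum_cons] at h ⊢
      rw [h, h1, h2]
  have hsub : ∀ j s, ∃ l : ℕ → List (SymmL2 τ × SymmL2 τ),
      ∀ᵐ ω ∂P, Tendsto (fun n => elemIntegral (V j) (l n) ω) atTop (𝓝 (Z j s ω)) := by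
    intro j s
    obtain ⟨l, -, hl⟩ := (hZ j s).approx
    have hm : TendstoInMeasure P (fun n => elemIntegral (W j) (l n)) atTop (Z j s) := by
      refine tendstoInMeasure_of_tendsto_eLpNorm (p := 2) (by norm_num)
        (fun n => (memLp_elemIntegral hW j (l n)).1) (hZ j s).memLp.1 (hl.congr fun n => ?_)
      exact eLpNorm_sub_comm (Z j s) (elemIntegral (W j) (l n)) 2 P
    obtain ⟨ns, -, hns⟩ := hm.exists_seq_tendsto_ae
    refine ⟨fun n => l (ns n), ?_⟩
    filter_upwards [hns, ae_all_iff.2 fun n => hae j (l (ns n))] with ω h1 h2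
    simpa only [h2] using h1
  choose l hl using hsub
  -- The almost sure limit along a subsequence is written as a `limsup`, which is a measurable
  -- functional of the whole path of `V j` with no convergence assumed.
  let G : ι → (SymmL2 τ → ℝ) → S → ℝ := fun j x s =>
    limsup (fun n => elemIntegral (fun φ (y : SymmL2 τ → ℝ) => y φ) (l j s n) x) atTop
  have hG : ∀ j, Measurable (G j) := fun j => by
    refine measurable_pi_lambda _ fun s => Measurable.limsup fun n => ?_
    induction l j s n with
    | nil => exact measurable_const
    | cons q m ih =>
      have e : elemIntegral (fun φ (y : SymmL2 τ → ℝ) => y φ) (q :: m) = fun y =>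
          (y q.1 * y q.2 - pairing q.1 q.2) + elemIntegral (fun φ y => y φ) m y := by
        ext y; simp [elemIntegral]
      rw [e]
      fun_prop
  refine (hind.comp G hG).process_congr fun j s => ?_
  filter_upwards [hl j s] with ω hω
  exact hω.limsup_eq

end Approximation

section GramKernel

variable {X : Type*} [MeasurableSpace X]

/-- The Gram kernel `(σ, σ') ↦ ∫ g_σ g_σ' dμ` of a family of nonnegative functions. -/
noncomputable def gram (μ : Measure X) (g : ℝ → X → ℝ≥0∞) (σ σ' : ℝ) : ℝ≥0∞ :=
  ∫⁻ x, g σ x * g σ' x ∂μ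

/-- The integral `∫_S g_σ dσ` of a family of nonnegative functions. -/
noncomputable def setIntegral (g : ℝ → X → ℝ≥0∞) (S : Set ℝ) (x : X) : ℝ≥0∞ :=
  ∫⁻ σ in S, g σ x

/-- The integrated kernel `∫_S g_σ ⊗ g_σ dσ`. -/
noncomputable def diagKernel (g : ℝ → X → ℝ≥0∞) (S : Set ℝ) (p : X × X) : ℝ≥0∞ :=
  ∫⁻ σ in S, g σ p.1 * g σ p.2

variable {μ : Measure X} [SFinite μ] {g : ℝ → X → ℝ≥0∞} (hg : Measurable (Function.uncurry g))
include hg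

omit [MeasurableSpace X] [SFinite μ] hg in
lemma measurable_comp_family {Y : Type*} [MeasurableSpace Y] [MeasurableSpace X]
    (hg : Measurable (Function.uncurry g)) {a : Y → ℝ} {b : Y → X} (ha : Measurable a)
    (hb : Measurable b) : Measurable fun y => g (a y) (b y) :=
  hg.comp (ha.prodMk hb)

lemma measurable_gram : Measurable (Function.uncurry (gram μ g)) := by
  refine Measurable.lintegral_prod_right' (f := fun q : (ℝ × ℝ) × X => g q.1.1 q.2 * g q.1.2 q.2) ?_
  exact (measurable_comp_family hg (by fun_prop) (by fun_prop)).mul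
    (measurable_comp_family hg (by fun_prop) (by fun_prop))

omit [SFinite μ] in
lemma measurable_setIntegral (S : Set ℝ) : Measurable (setIntegral g S) := by
  refine Measurable.lintegral_prod_right' (f := fun q : X × ℝ => g q.2 q.1) ?_
  exact measurable_comp_family hg (by fun_prop) (by fun_prop)

omit [SFinite μ] in
lemma measurable_diagKernel (S : Set ℝ) : Measurable (diagKernel g S) := by
  refine Measurable.lintegral_prod_right'
    (f := fun q : (X × X) × ℝ => g q.2 q.1.1 * g q.2 q.1.2) ?_
  exact (measurable_comp_family hg (by fun_prop) (by fun_prop)).mul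
    (measurable_comp_family hg (by fun_prop) (by fun_prop))

omit [SFinite μ] in
lemma measurable_family (σ : ℝ) : Measurable (g σ) :=
  measurable_comp_family hg measurable_const measurable_id

lemma lintegral_mul_setIntegral (S : Set ℝ) (σ : ℝ) :
    ∫⁻ x, g σ x * setIntegral g S x ∂μ = ∫⁻ τ in S, gram μ g σ τ := by
  simp only [setIntegral, gram]
  rw [lintegral_lintegral_swap]
  · refine lintegral_congr fun x => ?_
    rw [lintegral_const_mul]
    exact measurable_comp_family hg measurable_id measurable_const
  · refine Measurable.aemeasurable ?_
    exact (measurable_comp_family hg measurable_const (by fun_prop)).mul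
      (measurable_comp_family hg (by fun_prop) (by fun_prop))

lemma lintegral_setIntegral_mul_setIntegral (S S' : Set ℝ) :
    ∫⁻ x, setIntegral g S x * setIntegral g S' x ∂μ = ∫⁻ σ in S, ∫⁻ τ in S', gram μ g σ τ := by
  simp_rw [← lintegral_mul_setIntegral hg]
  rw [lintegral_lintegral_swap]
  · refine lintegral_congr fun x => ?_
    rw [lintegral_mul_const]
    · rfl
    · exact measurable_comp_family hg measurable_id measurable_const
  · refine Measurable.aemeasurable ?_
    exact (measurable_comp_family hg (by fun_prop) (by fun_prop)).mul
      ((measurable_setIntegral hg S').comp measurable_snd)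

/-- By Tonelli, since `⟨g_σ ⊗ g_σ, g_τ ⊗ g_τ⟩ = ⟨g_σ, g_τ⟩²`. This and the next two identities
express every norm and inner product of kernels through `gram` alone. -/
lemma lintegral_diagKernel_sq (S : Set ℝ) :
    ∫⁻ p, diagKernel g S p ^ 2 ∂(μ.prod μ) = ∫⁻ σ in S, ∫⁻ τ in S, gram μ g σ τ ^ 2 := by
  have h1 : ∀ σ, ∫⁻ τ in S, gram μ g σ τ ^ 2 =
      ∫⁻ p, (g σ p.1 * g σ p.2) * diagKernel g S p ∂(μ.prod μ) := by
    intro σ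
    have : ∀ p : X × X, (g σ p.1 * g σ p.2) * diagKernel g S p =
        ∫⁻ τ in S, (g σ p.1 * g τ p.1) * (g σ p.2 * g τ p.2) := fun p => by
      rw [diagKernel, ← lintegral_const_mul]
      · refine lintegral_congr fun τ => ?_
        ring
      · exact (measurable_comp_family hg (by fun_prop) (by fun_prop)).mul
          (measurable_comp_family hg (by fun_prop) (by fun_prop))
    simp_rw [this]
    rw [lintegral_lintegral_swap]
    · refine lintegral_congr fun τ => ?_
      have hm : Measurable fun x => g σ x * g τ x :=
        (measurable_family hg σ).mul (measurable_family hg τ)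
      rw [lintegral_prod_mul (f := fun x => g σ x * g τ x) (g := fun x => g σ x * g τ x)
        hm.aemeasurable hm.aemeasurable, gram, sq]
    · refine Measurable.aemeasurable ?_
      exact ((measurable_comp_family hg (by fun_prop) (by fun_prop)).mul
        (measurable_comp_family hg (by fun_prop) (by fun_prop))).mul
        ((measurable_comp_family hg (by fun_prop) (by fun_prop)).mul
        (measurable_comp_family hg (by fun_prop) (by fun_prop)))
  simp_rw [h1]
  rw [lintegral_lintegral_swap]
  · refine lintegral_congr fun p => ?_
    rw [lintegral_mul_const, sq]
    · rfl
    · exact (measurable_comp_family hg (by fun_prop) (by fun_prop)).mul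
          (measurable_comp_family hg (by fun_prop) (by fun_prop))
  · refine Measurable.aemeasurable ?_
    exact ((measurable_comp_family hg (by fun_prop) (by fun_prop)).mul
        (measurable_comp_family hg (by fun_prop) (by fun_prop))).mul
        ((measurable_diagKernel hg S).comp measurable_snd)

lemma lintegral_diagKernel_mul_tensor (T S : Set ℝ) :
    ∫⁻ p, diagKernel g T p * (setIntegral g S p.1 * setIntegral g S p.2) ∂(μ.prod μ)
      = ∫⁻ σ in T, (∫⁻ τ in S, gram μ g σ τ) ^ 2 := by
  have hs := measurable_setIntegral hg S
  have h1 : ∀ σ, (∫⁻ τ in S, gram μ g σ τ) ^ 2 =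
      ∫⁻ p, (g σ p.1 * g σ p.2) * (setIntegral g S p.1 * setIntegral g S p.2) ∂(μ.prod μ) := by
    intro σ
    have hm : Measurable fun x => g σ x * setIntegral g S x := (measurable_family hg σ).mul hs
    rw [← lintegral_mul_setIntegral hg, sq, ← lintegral_prod_mul hm.aemeasurable hm.aemeasurable]
    refine lintegral_congr fun p => ?_
    ring
  simp_rw [h1]
  rw [lintegral_lintegral_swap]
  · refine lintegral_congr fun p => ?_
    rw [lintegral_mul_const]
    · rfl
    · exact (measurable_comp_family hg (by fun_prop) (by fun_prop)).mul
          (measurable_comp_family hg (by fun_prop) (by fun_prop))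
  · refine Measurable.aemeasurable ?_
    exact ((measurable_comp_family hg (by fun_prop) (by fun_prop)).mul
        (measurable_comp_family hg (by fun_prop) (by fun_prop))).mul
        ((hs.comp (by fun_prop)).mul (hs.comp (by fun_prop)))

lemma lintegral_tensor_mul_tensor (S S' : Set ℝ) :
    ∫⁻ p, (setIntegral g S p.1 * setIntegral g S p.2) *
        (setIntegral g S' p.1 * setIntegral g S' p.2) ∂(μ.prod μ)
      = (∫⁻ σ in S, ∫⁻ τ in S', gram μ g σ τ) ^ 2 := by
  have hm : Measurable fun x => setIntegral g S x * setIntegral g S' x :=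
    (measurable_setIntegral hg S).mul (measurable_setIntegral hg S')
  rw [← lintegral_setIntegral_mul_setIntegral hg, sq,
    ← lintegral_prod_mul hm.aemeasurable hm.aemeasurable]
  refine lintegral_congr fun p => ?_
  ring

end GramKernel

/-! ### Partition of `(0, t]` into equal cells. -/

section Partition

/-- The `i`-th cell of the partition of `(0, t]` into `n` intervals of equal length. -/
def cell (t : ℝ) (n i : ℕ) : Set ℝ := Set.Ioc (i * (t / n)) ((i + 1) * (t / n))

lemma volume_cell (t : ℝ) (n i : ℕ) : volume (cell t n i) = ENNReal.ofReal (t / n) := by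
  rw [cell, Real.volume_Ioc]; congr 1; ring

lemma measurableSet_cell (t : ℝ) (n i : ℕ) : MeasurableSet (cell t n i) := measurableSet_Ioc

lemma exists_mem_cell {t : ℝ} (ht : 0 < t) {n : ℕ} (hn : n ≠ 0) {x : ℝ} (hx : x ∈ Set.Ioc 0 t) :
    ∃ i < n, x ∈ cell t n i := by
  have hn' : (0 : ℝ) < n := by positivity
  have hd : 0 < t / n := by positivity
  have hpos : 0 < x / (t / n) := div_pos hx.1 hd
  have hc : 0 < ⌈x / (t / n)⌉₊ := Nat.ceil_pos.2 hpos
  have hle : ⌈x / (t / n)⌉₊ ≤ n := by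
    rw [Nat.ceil_le, div_le_iff₀ hd]
    field_simp
    exact hx.2
  -- Cells are open on the left and closed on the right, hence a ceiling minus one rather than a
  -- floor.
  refine ⟨⌈x / (t / n)⌉₊ - 1, by omega, ?_, ?_⟩
  · rw [← lt_div_iff₀ hd]
    have := Nat.ceil_lt_add_one hpos.le
    rw [Nat.cast_sub (by omega)]
    push_cast; linarith
  · rw [← div_le_iff₀ hd, Nat.cast_sub (by omega)]
    push_cast
    rw [sub_add_cancel]
    exact Nat.le_ceil _

lemma disjoint_cell {t : ℝ} (ht : 0 < t) {n : ℕ} (hn : n ≠ 0) {i j : ℕ} (hij : i < j) :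
    Disjoint (cell t n i) (cell t n j) := by
  refine Set.disjoint_left.2 fun x hx hx' => ?_
  have hd : 0 < t / n := by positivity
  have h : ((i : ℝ) + 1) ≤ j := by exact_mod_cast hij
  have := mul_le_mul_of_nonneg_right h hd.le
  exact absurd (hx.2.trans this) (not_le.2 hx'.1)

lemma iUnion_cell {t : ℝ} (ht : 0 < t) {n : ℕ} (hn : n ≠ 0) :
    ⋃ i ∈ Finset.range n, cell t n i = Set.Ioc 0 t := by
  ext x
  simp only [Finset.mem_range, Set.mem_iUnion, exists_prop]
  refine ⟨?_, exists_mem_cell ht hn⟩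
  rintro ⟨i, hi, h1, h2⟩
  have hd : 0 < t / n := by positivity
  refine ⟨lt_of_le_of_lt (by positivity) h1, h2.trans ?_⟩
  have h : ((i : ℝ) + 1) ≤ n := by exact_mod_cast hi
  calc ((i : ℝ) + 1) * (t / n) ≤ n * (t / n) := mul_le_mul_of_nonneg_right h hd.le
    _ = t := by field_simp

lemma sum_lintegral_cell {t : ℝ} (ht : 0 < t) {n : ℕ} (hn : n ≠ 0) (f : ℝ → ℝ≥0∞) :
    ∑ i ∈ Finset.range n, ∫⁻ x in cell t n i, f x = ∫⁻ x in Set.Ioc 0 t, f x := by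
  rw [← iUnion_cell ht hn, lintegral_biUnion_finset _ fun i _ => measurableSet_cell t n i]
  intro i _ j _ hij
  rcases lt_or_gt_of_ne hij with h | h
  · exact disjoint_cell ht hn h
  · exact (disjoint_cell ht hn h).symm

lemma lintegral_sq_le (S : Set ℝ) {f : ℝ → ℝ≥0∞} (hf : Measurable f) :
    (∫⁻ x in S, f x) ^ 2 ≤ volume S * ∫⁻ x in S, f x ^ 2 := by
  have h := ENNReal.lintegral_mul_le_Lp_mul_Lq (volume.restrict S) Real.HolderConjugate.two_two
    (f := fun _ => 1) (g := f) aemeasurable_const hf.aemeasurable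
  simp only [Pi.mul_apply, one_mul, ENNReal.one_rpow, lintegral_const, Measure.restrict_apply,
    MeasurableSet.univ, Set.univ_inter] at h
  calc (∫⁻ x in S, f x) ^ 2 ≤ (volume S ^ (1 / 2 : ℝ) *
        (∫⁻ x in S, f x ^ (2 : ℝ)) ^ (1 / 2 : ℝ)) ^ 2 := by gcongr
    _ = volume S * ∫⁻ x in S, f x ^ 2 := by
      rw [mul_pow, ← ENNReal.rpow_natCast, ← ENNReal.rpow_natCast, ← ENNReal.rpow_mul,
        ← ENNReal.rpow_mul]
      norm_num

end Partition

/-! ### `L²` convergence of the cell averages of the kernel. -/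

section Convergence

variable {X : Type*} [MeasurableSpace X]

/-- The approximation of `diagKernel` obtained by averaging over the cells of a partition. -/
noncomputable def cellKernel (g : ℝ → X → ℝ≥0∞) (t : ℝ) (n : ℕ) (p : X × X) : ℝ≥0∞ :=
  ∑ i ∈ Finset.range n, ENNReal.ofReal (n / t) *
    (setIntegral g (cell t n i) p.1 * setIntegral g (cell t n i) p.2)

lemma ofReal_div_mul_ofReal_div {t : ℝ} (ht : 0 < t) {n : ℕ} (hn : n ≠ 0) :
    ENNReal.ofReal (n / t) * ENNReal.ofReal (t / n) = 1 := by
  have hn' : (0 : ℝ) < n := by positivity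
  rw [← ENNReal.ofReal_mul (by positivity), ← ENNReal.ofReal_one]
  congr 1; field_simp

variable {μ : Measure X} [SFinite μ] {g : ℝ → X → ℝ≥0∞} (hg : Measurable (Function.uncurry g))
include hg

omit [SFinite μ] in
lemma measurable_cellKernel (t : ℝ) (n : ℕ) : Measurable (cellKernel g t n) := by
  unfold cellKernel
  refine Finset.measurable_fun_sum _ fun i _ => ?_
  have := measurable_setIntegral hg (cell t n i)
  exact ((this.comp measurable_fst).mul (this.comp measurable_snd)).const_mul _

lemma lintegral_diagKernel_mul_cellKernel (T : Set ℝ) (t : ℝ) (n : ℕ) :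
    ∫⁻ p, diagKernel g T p * cellKernel g t n p ∂(μ.prod μ) =
      ∑ i ∈ Finset.range n, ENNReal.ofReal (n / t) *
        ∫⁻ σ in T, (∫⁻ τ in cell t n i, gram μ g σ τ) ^ 2 := by
  have hm : ∀ i, Measurable fun p : X × X =>
      diagKernel g T p * (setIntegral g (cell t n i) p.1 * setIntegral g (cell t n i) p.2) :=
    fun i => (measurable_diagKernel hg T).mul
      (((measurable_setIntegral hg _).comp measurable_fst).mul
        ((measurable_setIntegral hg _).comp measurable_snd))
  simp_rw [← lintegral_diagKernel_mul_tensor hg, cellKernel, Finset.mul_sum]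
  rw [lintegral_finsetSum]
  · refine Finset.sum_congr rfl fun i _ => ?_
    rw [← lintegral_const_mul _ (hm i)]
    refine lintegral_congr fun p => ?_
    ring
  · intro i _
    have e : (fun p => diagKernel g T p * (ENNReal.ofReal (n / t) *
        (setIntegral g (cell t n i) p.1 * setIntegral g (cell t n i) p.2))) =
        fun p => ENNReal.ofReal (n / t) * (diagKernel g T p *
        (setIntegral g (cell t n i) p.1 * setIntegral g (cell t n i) p.2)) := by
      ext p; ring
    rw [e]
    exact (hm i).const_mul _

lemma lintegral_cellKernel_sq (t : ℝ) (n : ℕ) :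
    ∫⁻ p, cellKernel g t n p ^ 2 ∂(μ.prod μ) =
      ∑ i ∈ Finset.range n, ∑ j ∈ Finset.range n, ENNReal.ofReal (n / t) ^ 2 *
        (∫⁻ σ in cell t n i, ∫⁻ τ in cell t n j, gram μ g σ τ) ^ 2 := by
  have hs := fun i => measurable_setIntegral hg (cell t n i)
  have hm : ∀ i j, Measurable fun p : X × X =>
      (setIntegral g (cell t n i) p.1 * setIntegral g (cell t n i) p.2) *
        (setIntegral g (cell t n j) p.1 * setIntegral g (cell t n j) p.2) :=
    fun i j => (((hs i).comp measurable_fst).mul ((hs i).comp measurable_snd)).mul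
      (((hs j).comp measurable_fst).mul ((hs j).comp measurable_snd))
  have e : ∀ p, cellKernel g t n p ^ 2 = ∑ i ∈ Finset.range n, ∑ j ∈ Finset.range n,
      ENNReal.ofReal (n / t) ^ 2 *
      ((setIntegral g (cell t n i) p.1 * setIntegral g (cell t n i) p.2) *
        (setIntegral g (cell t n j) p.1 * setIntegral g (cell t n j) p.2)) := fun p => by
    rw [sq, cellKernel, Finset.sum_mul_sum]
    refine Finset.sum_congr rfl fun i _ => Finset.sum_congr rfl fun j _ => ?_
    ring
  simp_rw [e, ← lintegral_tensor_mul_tensor hg]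
  rw [lintegral_finsetSum _ fun i _ =>
    Finset.measurable_fun_sum _ fun j _ => (hm i j).const_mul _]
  refine Finset.sum_congr rfl fun i _ => ?_
  rw [lintegral_finsetSum _ fun j _ => (hm i j).const_mul _]
  refine Finset.sum_congr rfl fun j _ => ?_
  rw [lintegral_const_mul _ (hm i j)]

/-- Cauchy–Schwarz on each cell in the variable `σ`: a cell has length `t / n`, which cancels one of
the two factors `n / t`. -/
lemma lintegral_cellKernel_sq_le {t : ℝ} (ht : 0 < t) {n : ℕ} (hn : n ≠ 0) :
    ∫⁻ p, cellKernel g t n p ^ 2 ∂(μ.prod μ) ≤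
      ∫⁻ p, diagKernel g (Set.Ioc 0 t) p * cellKernel g t n p ∂(μ.prod μ) := by
  rw [lintegral_diagKernel_mul_cellKernel hg, lintegral_cellKernel_sq hg, Finset.sum_comm]
  refine Finset.sum_le_sum fun j _ => ?_
  rw [← sum_lintegral_cell ht hn, Finset.mul_sum]
  refine Finset.sum_le_sum fun i _ => ?_
  have hm : Measurable fun σ => ∫⁻ τ in cell t n j, gram μ g σ τ :=
    Measurable.lintegral_prod_right' (f := fun q : ℝ × ℝ => gram μ g q.1 q.2) (measurable_gram hg)
  calc ENNReal.ofReal (n / t) ^ 2 * (∫⁻ σ in cell t n i, ∫⁻ τ in cell t n j, gram μ g σ τ) ^ 2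
      ≤ ENNReal.ofReal (n / t) ^ 2 * (ENNReal.ofReal (t / n) *
        ∫⁻ σ in cell t n i, (∫⁻ τ in cell t n j, gram μ g σ τ) ^ 2) := by
        gcongr
        rw [← volume_cell t n i]
        exact lintegral_sq_le _ hm
    _ = ENNReal.ofReal (n / t) * (ENNReal.ofReal (n / t) * ENNReal.ofReal (t / n)) *
        ∫⁻ σ in cell t n i, (∫⁻ τ in cell t n j, gram μ g σ τ) ^ 2 := by ring
    _ = _ := by rw [ofReal_div_mul_ofReal_div ht hn, mul_one]

omit hg [SFinite μ] in
/-- Averages over the cells of finer and finer partitions recover a continuous function. -/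
lemma sq_le_liminf_average {f : ℝ → ℝ≥0∞} {t x : ℝ} (ht : 0 < t) (hx : x ∈ Set.Ioc 0 t)
    (hf : ContinuousAt f x) :
    f x ^ 2 ≤ liminf (fun n : ℕ => ∑ i ∈ Finset.range n, (cell t n i).indicator
      (fun _ => (ENNReal.ofReal (n / t) * ∫⁻ y in cell t n i, f y) ^ 2) x) atTop := by
  refine le_of_forall_lt fun c hc => ?_
  -- A level strictly below `f x` is chosen because `f x` may be infinite; near `x`, hence on the
  -- whole cell of `x` for large `n`, the function exceeds `b`.
  obtain ⟨b, hb, hb'⟩ : ∃ b, c < b ^ 2 ∧ b < f x := by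
    have hcont : ContinuousAt (fun y : ℝ≥0∞ => y ^ 2) (f x) :=
      (ENNReal.continuous_pow 2).continuousAt
    have hne : f x ≠ 0 := by
      rintro h; rw [h] at hc; simp at hc
    have hev := hcont.eventually (lt_mem_nhds hc)
    have : (𝓝[<] (f x)).NeBot := by
      refine mem_closure_iff_nhdsWithin_neBot.1 ?_
      rw [closure_Iio' ⟨0, pos_iff_ne_zero.2 hne⟩]
      exact Set.self_mem_Iic
    have hev' : ∀ᶠ y in 𝓝[<] (f x), c < y ^ 2 := nhdsWithin_le_nhds hev
    obtain ⟨b, hb1, hb2⟩ := (hev'.and self_mem_nhdsWithin).exists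
    exact ⟨b, hb1, hb2⟩
  refine hb.trans_le (le_liminf_of_le (by isBoundedDefault) ?_)
  obtain ⟨δ, hδ, hball⟩ := Metric.eventually_nhds_iff.1 (hf.eventually (lt_mem_nhds hb'))
  have hlim : Tendsto (fun n : ℕ => t / n) atTop (𝓝 0) := tendsto_const_div_atTop_nhds_zero_nat t
  filter_upwards [hlim.eventually (gt_mem_nhds hδ), eventually_ne_atTop 0] with n hn hn0
  obtain ⟨i, hi, hxi⟩ := exists_mem_cell ht hn0 hx
  have hb2 : b ≤ ENNReal.ofReal (n / t) * ∫⁻ y in cell t n i, f y := by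
    calc b = ENNReal.ofReal (n / t) * ∫⁻ y in cell t n i, b := by
          rw [lintegral_const, Measure.restrict_apply_univ, volume_cell, mul_comm b, ← mul_assoc,
            ofReal_div_mul_ofReal_div ht hn0, one_mul]
      _ ≤ _ := by
          refine mul_le_mul_right (setLIntegral_mono' (measurableSet_cell t n i) fun y hy => ?_) _
          refine (hball ?_).le
          rw [Real.dist_eq, abs_lt]
          have h1 := hy.1; have h2 := hy.2; have h3 := hxi.1; have h4 := hxi.2
          constructor <;> nlinarith
  refine le_trans ?_ (Finset.single_le_sum (f := fun i => (cell t n i).indicator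
    (fun _ => (ENNReal.ofReal (n / t) * ∫⁻ y in cell t n i, f y) ^ 2) x)
      (fun _ _ => zero_le) (Finset.mem_range.2 hi))
  simp only [Set.indicator_of_mem hxi]
  gcongr

/-- Fatou's lemma on the square `(0, t]²`: the inner product is the integral of squared cell
averages of `gram` in the second variable, and these recover `gram²` off the diagonal, a null set.
-/
lemma lintegral_diagKernel_sq_le_liminf {t : ℝ} (ht : 0 < t)
    (hcont : ∀ σ τ, σ ≠ τ → ContinuousAt (gram μ g σ) τ) :
    ∫⁻ p, diagKernel g (Set.Ioc 0 t) p ^ 2 ∂(μ.prod μ) ≤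
      liminf (fun n => ∫⁻ p, diagKernel g (Set.Ioc 0 t) p * cellKernel g t n p ∂(μ.prod μ))
        atTop := by
  set ν := (volume : Measure ℝ).restrict (Set.Ioc 0 t) with hν
  let r : ℕ → ℝ × ℝ → ℝ≥0∞ := fun n q => ∑ i ∈ Finset.range n, (cell t n i).indicator
      (fun _ => (ENNReal.ofReal (n / t) * ∫⁻ y in cell t n i, gram μ g q.1 y) ^ 2) q.2
  have hcm : ∀ n i, Measurable fun σ => ∫⁻ y in cell t n i, gram μ g σ y := fun n i =>
    Measurable.lintegral_prod_right' (f := fun q : ℝ × ℝ => gram μ g q.1 q.2) (measurable_gram hg)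
  have hr : ∀ n, Measurable (r n) := fun n => by
    refine Finset.measurable_fun_sum _ fun i _ => ?_
    have e : (fun q : ℝ × ℝ => (cell t n i).indicator
      (fun _ => (ENNReal.ofReal (n / t) * ∫⁻ y in cell t n i, gram μ g q.1 y) ^ 2) q.2) =
        (Prod.snd ⁻¹' cell t n i).indicator
        (fun q => (ENNReal.ofReal (n / t) * ∫⁻ y in cell t n i, gram μ g q.1 y) ^ 2) := by
      ext q; simp only [Set.indicator, Set.mem_preimage]; rfl
    rw [e]
    exact ((((hcm n i).comp measurable_fst).const_mul _).pow_const 2).indicator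
      (measurable_snd (measurableSet_cell t n i))
  have hA : ∫⁻ p, diagKernel g (Set.Ioc 0 t) p ^ 2 ∂(μ.prod μ) =
      ∫⁻ q, gram μ g q.1 q.2 ^ 2 ∂(ν.prod ν) := by
    rw [lintegral_diagKernel_sq hg, lintegral_prod]
    exact ((measurable_gram hg).pow_const 2).aemeasurable
  have hB : ∀ᶠ n in atTop, ∫⁻ q, r n q ∂(ν.prod ν) =
      ∫⁻ p, diagKernel g (Set.Ioc 0 t) p * cellKernel g t n p ∂(μ.prod μ) := by
    filter_upwards [eventually_ne_atTop 0] with n hn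
    rw [lintegral_diagKernel_mul_cellKernel hg, lintegral_prod _ (hr n).aemeasurable]
    have h1 : ∀ σ, ∫⁻ τ, r n (σ, τ) ∂ν = ∑ i ∈ Finset.range n, ENNReal.ofReal (n / t) *
        (∫⁻ y in cell t n i, gram μ g σ y) ^ 2 := by
      intro σ
      simp only [r]
      rw [lintegral_finsetSum]
      · refine Finset.sum_congr rfl fun i hi => ?_
        rw [lintegral_indicator_const (measurableSet_cell t n i), hν,
          Measure.restrict_apply (measurableSet_cell t n i), Set.inter_eq_left.2, volume_cell,
          mul_pow, sq (ENNReal.ofReal (n / t))]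
        · calc _ = ENNReal.ofReal (n / t) * (∫⁻ y in cell t n i, gram μ g σ y) ^ 2 *
                (ENNReal.ofReal (n / t) * ENNReal.ofReal (t / n)) := by ring
            _ = _ := by rw [ofReal_div_mul_ofReal_div ht hn, mul_one]
        · rw [← iUnion_cell ht hn]
          exact Set.subset_biUnion_of_mem (u := fun i => cell t n i) hi
      · exact fun i _ => measurable_const.indicator (measurableSet_cell t n i)
    simp_rw [h1]
    rw [lintegral_finsetSum _ fun i _ => ((hcm n i).pow_const 2).const_mul _]
    refine Finset.sum_congr rfl fun i _ => ?_
    rw [lintegral_const_mul _ ((hcm n i).pow_const 2)]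
  rw [hA, ← liminf_congr hB]
  refine le_trans (lintegral_mono_ae ?_) (lintegral_liminf_le hr)
  have hdiag : ∀ᵐ q ∂(ν.prod ν), q.1 ≠ q.2 := by
    rw [Measure.ae_prod_iff_ae_ae]
    · refine ae_of_all _ fun σ => ?_
      rw [hν]
      refine ae_restrict_of_ae ?_
      filter_upwards [Measure.ae_ne volume σ] with τ hτ
      exact hτ.symm
    · exact (measurableSet_eq_fun measurable_fst measurable_snd).compl
  have hmem : ∀ᵐ q ∂(ν.prod ν), q.2 ∈ Set.Ioc 0 t := by
    rw [Measure.ae_prod_iff_ae_ae (measurable_snd measurableSet_Ioc)]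
    exact ae_of_all _ fun σ => ae_restrict_mem measurableSet_Ioc
  filter_upwards [hdiag, hmem] with q h1 h2
  exact sq_le_liminf_average ht h2 (hcont _ _ h1)

-- The expansion of `(a - b)²`, with the cross term moved across so that no truncated subtraction in
-- `ℝ≥0∞` occurs.
omit hg [SFinite μ] in
lemma enorm_toReal_sub_sq_add {a b : ℝ≥0∞} (ha : a ≠ ∞) (hb : b ≠ ∞) :
    ‖a.toReal - b.toReal‖ₑ ^ 2 + 2 * (a * b) = a ^ 2 + b ^ 2 := by
  lift a to ℝ≥0 using ha
  lift b to ℝ≥0 using hb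
  simp only [ENNReal.coe_toReal]
  rw [← ofReal_norm, ← ENNReal.ofReal_pow (norm_nonneg _), Real.norm_eq_abs, sq_abs,
    ← ENNReal.ofReal_coe_nnreal, ← ENNReal.ofReal_coe_nnreal, ← ENNReal.ofReal_mul (by positivity),
    ← ENNReal.ofReal_pow (by positivity), ← ENNReal.ofReal_pow (by positivity),
    show (2 : ℝ≥0∞) = ENNReal.ofReal 2 by simp, ← ENNReal.ofReal_mul (by positivity),
    ← ENNReal.ofReal_add (by positivity) (by positivity),
    ← ENNReal.ofReal_add (by positivity) (by positivity)]
  congr 1; ring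

omit hg [SFinite μ] in
lemma lintegral_gram_ne_top {T S S' : Set ℝ} (hT : volume T ≠ ∞) (hS : S ⊆ T) (hS' : S' ⊆ T)
    (hfin : ∫⁻ σ in T, ∫⁻ τ in T, gram μ g σ τ ^ 2 ≠ ∞) :
    ∫⁻ σ in S, ∫⁻ τ in S', gram μ g σ τ ≠ ∞ := by
  have hle : ∀ a : ℝ≥0∞, a ≤ 1 + a ^ 2 := fun a => by
    rcases le_total a 1 with h | h
    · exact h.trans le_self_add
    · exact (le_self_pow h two_ne_zero).trans le_add_self
  have hlt : ∫⁻ σ in T, ∫⁻ τ in T, (1 + gram μ g σ τ ^ 2) < ∞ := by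
    simp_rw [lintegral_add_left measurable_const]
    simp only [lintegral_const, Measure.restrict_apply_univ, one_mul]
    exact ENNReal.add_lt_top.2 ⟨ENNReal.mul_lt_top hT.lt_top hT.lt_top, hfin.lt_top⟩
  refine (lt_of_le_of_lt ?_ hlt).ne
  refine (lintegral_mono_set hS).trans (lintegral_mono fun σ => ?_)
  exact (lintegral_mono_set hS').trans (lintegral_mono fun τ => hle _)

omit hg [SFinite μ] in
lemma cell_subset {t : ℝ} (ht : 0 < t) {n i : ℕ} (hi : i < n) : cell t n i ⊆ Set.Ioc 0 t := by
  rw [← iUnion_cell ht (by omega : n ≠ 0)]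
  exact Set.subset_biUnion_of_mem (u := fun i => cell t n i) (Finset.mem_range.2 hi)

lemma lintegral_cellKernel_sq_ne_top {t : ℝ} (ht : 0 < t) (n : ℕ)
    (hfin : ∫⁻ σ in Set.Ioc 0 t, ∫⁻ τ in Set.Ioc 0 t, gram μ g σ τ ^ 2 ≠ ∞) :
    ∫⁻ p, cellKernel g t n p ^ 2 ∂(μ.prod μ) ≠ ∞ := by
  rw [lintegral_cellKernel_sq hg]
  refine ENNReal.sum_ne_top.2 fun i hi => ENNReal.sum_ne_top.2 fun j hj => ?_
  refine ENNReal.mul_ne_top (by simp) (ENNReal.pow_ne_top ?_)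
  exact lintegral_gram_ne_top (by simp) (cell_subset ht (Finset.mem_range.1 hi))
    (cell_subset ht (Finset.mem_range.1 hj)) hfin

omit hg [SFinite μ] in
lemma ae_ne_top_of_lintegral_sq {Y : Type*} [MeasurableSpace Y] {ν : Measure Y} {f : Y → ℝ≥0∞}
    (hf : Measurable f) (h : ∫⁻ y, f y ^ 2 ∂ν ≠ ∞) : ∀ᵐ y ∂ν, f y ≠ ∞ := by
  filter_upwards [ae_lt_top (hf.pow_const 2) h] with y hy hy'
  simp [hy'] at hy

/-- The averaged kernels converge to the integrated kernel in `L²`. -/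
lemma tendsto_lintegral_diagKernel_sub_cellKernel {t : ℝ} (ht : 0 < t)
    (hcont : ∀ σ τ, σ ≠ τ → ContinuousAt (gram μ g σ) τ)
    (hfin : ∫⁻ σ in Set.Ioc 0 t, ∫⁻ τ in Set.Ioc 0 t, gram μ g σ τ ^ 2 ≠ ∞) :
    Tendsto (fun n => ∫⁻ p, ‖(diagKernel g (Set.Ioc 0 t) p).toReal -
      (cellKernel g t n p).toReal‖ₑ ^ 2 ∂(μ.prod μ)) atTop (𝓝 0) := by
  have hdm := measurable_diagKernel hg (Set.Ioc 0 t)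
  have hcm := measurable_cellKernel hg t
  have hD := fun n => lintegral_cellKernel_sq_ne_top hg ht n hfin
  have hliminf := lintegral_diagKernel_sq_le_liminf hg ht hcont
  have hAfin : ∫⁻ p, diagKernel g (Set.Ioc 0 t) p ^ 2 ∂(μ.prod μ) ≠ ∞ := by
    rw [lintegral_diagKernel_sq hg]; exact hfin
  have hexp : ∀ n, ∫⁻ p, ‖(diagKernel g (Set.Ioc 0 t) p).toReal -
      (cellKernel g t n p).toReal‖ₑ ^ 2 ∂(μ.prod μ) +
      2 * ∫⁻ p, diagKernel g (Set.Ioc 0 t) p * cellKernel g t n p ∂(μ.prod μ) =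
      ∫⁻ p, diagKernel g (Set.Ioc 0 t) p ^ 2 ∂(μ.prod μ) +
        ∫⁻ p, cellKernel g t n p ^ 2 ∂(μ.prod μ) := fun n => by
    have hdc : Measurable fun p => diagKernel g (Set.Ioc 0 t) p * cellKernel g t n p :=
      hdm.mul (hcm n)
    rw [← lintegral_const_mul _ hdc, ← lintegral_add_left (hdm.pow_const 2),
      ← lintegral_add_right _ (hdc.const_mul 2)]
    refine lintegral_congr_ae ?_
    filter_upwards [ae_ne_top_of_lintegral_sq hdm hAfin, ae_ne_top_of_lintegral_sq (hcm n) (hD n)]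
      with p h1 h2
    exact enorm_toReal_sub_sq_add h1 h2
  generalize (∫⁻ p, diagKernel g (Set.Ioc 0 t) p ^ 2 ∂(μ.prod μ)) = A at *
  -- With `B` the inner product of the kernel with its approximation and `D ≤ B` the squared norm of
  -- the approximation, `A - 2B + D ≤ A - B`. Since `A ≤ liminf B`, this tends to zero.
  have hle : ∀ᶠ n in atTop, ∫⁻ p, ‖(diagKernel g (Set.Ioc 0 t) p).toReal -
      (cellKernel g t n p).toReal‖ₑ ^ 2 ∂(μ.prod μ) ≤
      A - ∫⁻ p, diagKernel g (Set.Ioc 0 t) p * cellKernel g t n p ∂(μ.prod μ) := by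
    filter_upwards [eventually_ne_atTop 0] with n hn
    have h1 := hexp n
    have h2 := lintegral_cellKernel_sq_le hg (μ := μ) ht hn
    have hBfin : ∫⁻ p, diagKernel g (Set.Ioc 0 t) p * cellKernel g t n p ∂(μ.prod μ) ≠ ∞ := by
      intro htop
      rw [htop, ENNReal.mul_top (by norm_num), add_top] at h1
      exact ENNReal.add_ne_top.2 ⟨hAfin, hD n⟩ h1.symm
    refine ENNReal.le_sub_of_add_le_right hBfin ?_
    rw [two_mul, ← add_assoc] at h1
    exact (ENNReal.add_le_add_iff_right hBfin).1 (h1.le.trans (by gcongr))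
  rw [ENNReal.tendsto_nhds_zero]
  intro ε hε
  by_cases hA0 : A = 0
  · filter_upwards [hle] with n hn
    exact hn.trans (by simp [hA0])
  · have hlt : A - ε < A := ENNReal.sub_lt_self hAfin hA0 hε.ne'
    filter_upwards [hle, eventually_lt_of_lt_liminf (hlt.trans_le hliminf)] with n h1 h2
    refine h1.trans ?_
    rw [tsub_le_iff_right]
    exact (tsub_le_iff_left.1 h2.le)

end Convergence

/-! ### Families with Gram kernel `C |σ - τ| ^ (H - 1)`. -/

section PowerGram

variable {X : Type*} [MeasurableSpace X]

lemma gram_comm (μ : Measure X) (g : ℝ → X → ℝ≥0∞) (σ τ : ℝ) : gram μ g σ τ = gram μ g τ σ := by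
  simp only [gram, mul_comm]

/-- The Gram kernel of a family of nonnegative functions, as a real integral. -/
lemma gram_ofReal_eq {μ : Measure X} {G : ℝ → X → ℝ} (h0 : ∀ σ x, 0 ≤ G σ x) {σ τ : ℝ}
    (hint : Integrable (fun x => G σ x * G τ x) μ) :
    gram μ (fun σ x => ENNReal.ofReal (G σ x)) σ τ = ENNReal.ofReal (∫ x, G σ x * G τ x ∂μ) := by
  rw [ofReal_integral_eq_lintegral_ofReal hint
    (ae_of_all _ fun x => mul_nonneg (h0 _ _) (h0 _ _)), gram]
  simp only [ENNReal.ofReal_mul (h0 _ _)]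

/-- A jointly measurable family of nonnegative functions whose Gram kernel is
`C |σ - τ| ^ (H - 1)` off the diagonal. -/
structure HasPowerGram (μ : Measure X) (G : ℝ → X → ℝ) (H C : ℝ) : Prop where
  measurable : Measurable (Function.uncurry G)
  nonneg : ∀ σ x, 0 ≤ G σ x
  gram_eq : ∀ σ τ, σ ≠ τ → gram μ (fun σ x => ENNReal.ofReal (G σ x)) σ τ =
    ENNReal.ofReal (C * |σ - τ| ^ (H - 1))

lemma HasPowerGram.of_gram_lt {μ : Measure X} {G : ℝ → X → ℝ} {H C : ℝ}
    (hm : Measurable (Function.uncurry G)) (h0 : ∀ σ x, 0 ≤ G σ x)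
    (key : ∀ σ τ, σ < τ → gram μ (fun σ x => ENNReal.ofReal (G σ x)) σ τ =
      ENNReal.ofReal (C * (τ - σ) ^ (H - 1))) :
    HasPowerGram μ G H C := by
  refine ⟨hm, h0, fun σ τ h => ?_⟩
  rcases lt_or_gt_of_ne h with h | h
  · rw [key σ τ h, abs_sub_comm, abs_of_pos (sub_pos.2 h)]
  · rw [gram_comm, key τ σ h, abs_of_pos (sub_pos.2 h)]

lemma HasPowerGram.of_lt {μ : Measure X} {G : ℝ → X → ℝ} {H C : ℝ}
    (hm : Measurable (Function.uncurry G)) (h0 : ∀ σ x, 0 ≤ G σ x)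
    (hint : ∀ σ τ, σ < τ → Integrable (fun x => G σ x * G τ x) μ)
    (heq : ∀ σ τ, σ < τ → ∫ x, G σ x * G τ x ∂μ = C * (τ - σ) ^ (H - 1)) :
    HasPowerGram μ G H C :=
  .of_gram_lt hm h0 fun σ τ h => by rw [gram_ofReal_eq h0 (hint σ τ h), heq σ τ h]

variable {μ : Measure X} {G : ℝ → X → ℝ} {H C : ℝ} (hG : HasPowerGram μ G H C)
include hG

lemma HasPowerGram.measurable_ofReal :
    Measurable (Function.uncurry fun σ x => ENNReal.ofReal (G σ x)) :=
  hG.measurable.ennreal_ofReal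

lemma HasPowerGram.const_mul {c : ℝ} (hc : 0 ≤ c) :
    HasPowerGram μ (fun σ x => c * G σ x) H (c ^ 2 * C) := by
  refine ⟨hG.measurable.const_mul c, fun σ x => mul_nonneg hc (hG.nonneg σ x), fun σ τ h => ?_⟩
  have hm : Measurable fun x => ENNReal.ofReal (G σ x) * ENNReal.ofReal (G τ x) :=
    (measurable_family hG.measurable_ofReal σ).mul (measurable_family hG.measurable_ofReal τ)
  have := hG.gram_eq σ τ h
  rw [gram] at this ⊢
  simp only [ENNReal.ofReal_mul hc]
  rw [mul_assoc, ENNReal.ofReal_mul (sq_nonneg c), ← this, ← lintegral_const_mul _ hm]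
  refine lintegral_congr fun x => ?_
  rw [sq, ENNReal.ofReal_mul hc]; ring

lemma HasPowerGram.continuousAt (σ τ : ℝ) (h : σ ≠ τ) :
    ContinuousAt (gram μ (fun σ x => ENNReal.ofReal (G σ x)) σ) τ := by
  have hc : ContinuousAt (fun τ => ENNReal.ofReal (C * |σ - τ| ^ (H - 1))) τ := by
    refine ENNReal.continuous_ofReal.continuousAt.comp ?_
    refine continuousAt_const.mul (ContinuousAt.rpow_const (by fun_prop) ?_)
    left
    simpa [sub_eq_zero] using h
  refine hc.congr ?_
  filter_upwards [isOpen_ne.mem_nhds h.symm] with y hy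
  exact (hG.gram_eq σ y hy.symm).symm

omit hG in
lemma integrable_indicator_abs_rpow {r : ℝ} (hr : -1 < r) (R : ℝ) :
    Integrable (fun v : ℝ => (Set.Iio R).indicator (fun u => u ^ r) |v|) := by
  have h := integrable_fun_norm_addHaar (E := ℝ) (volume : Measure ℝ)
    (f := (Set.Iio R).indicator (fun u => u ^ r))
  simp only [Real.norm_eq_abs] at h
  rw [h]
  simp only [Module.finrank_self, Nat.sub_self, pow_zero, one_smul]
  rw [integrableOn_indicator_iff measurableSet_Iio]
  refine (intervalIntegral.intervalIntegrable_rpow' (a := 0) (b := R) hr).1.mono_set ?_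
  rintro u ⟨h1, h2⟩
  exact ⟨h2, le_of_lt h1⟩

/-- The squared Gram kernel is a multiple of `|σ - τ|^(2H-2)`, locally integrable since `2H - 2 >
-1`. Translation bounds the inner integral uniformly in `σ`. -/
lemma HasPowerGram.lintegral_gram_sq_ne_top (hH : 1 / 2 < H) (t : ℝ) :
    ∫⁻ σ in Set.Ioc 0 t, ∫⁻ τ in Set.Ioc 0 t,
      gram μ (fun σ x => ENNReal.ofReal (G σ x)) σ τ ^ 2 ≠ ∞ := by
  have hI := integrable_indicator_abs_rpow (r := 2 * H - 2) (by linarith) (t + 1)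
  set F : ℝ → ℝ := fun v => (Set.Iio (t + 1)).indicator (fun u => u ^ (2 * H - 2)) |v| with hF
  have hfin : ∫⁻ v, ENNReal.ofReal (C ^ 2 * F v) ≠ ∞ :=
    ((hI.const_mul (C ^ 2)).lintegral_lt_top).ne
  have hle : ∀ σ ∈ Set.Ioc 0 t, ∫⁻ τ in Set.Ioc 0 t,
      gram μ (fun σ x => ENNReal.ofReal (G σ x)) σ τ ^ 2 ≤
      ∫⁻ v, ENNReal.ofReal (C ^ 2 * F v) := by
    intro σ hσ
    rw [← lintegral_sub_left_eq_self (fun v => ENNReal.ofReal (C ^ 2 * F v)) σ]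
    refine le_trans (lintegral_mono_ae ?_) (setLIntegral_le_lintegral (Set.Ioc 0 t) _)
    filter_upwards [ae_restrict_mem measurableSet_Ioc,
      ae_restrict_of_ae (Measure.ae_ne volume σ)] with τ hτ hne
    have hlt : |σ - τ| < t + 1 := by
      rw [abs_lt]; constructor <;> linarith [hσ.1, hσ.2, hτ.1, hτ.2]
    have hpos : 0 < |σ - τ| := abs_pos.2 (sub_ne_zero.2 hne.symm)
    rw [hG.gram_eq σ τ hne.symm, hF]
    simp only
    rw [Set.indicator_of_mem (by exact hlt), show 2 * H - 2 = (H - 1) + (H - 1) by ring,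
      Real.rpow_add hpos, ← sq, ← mul_pow, ← sq_abs (C * _), ENNReal.ofReal_pow (abs_nonneg _)]
    gcongr
    exact le_abs_self _
  refine (lt_of_le_of_lt (setLIntegral_mono' measurableSet_Ioc hle) ?_).ne
  rw [setLIntegral_const]
  exact ENNReal.mul_lt_top hfin.lt_top (by simp)

end PowerGram

/-! ### The Gram kernel of the Rosenblatt family. -/

section Rosenblatt

/-- The family `σ ↦ (σ - y)_+^{-(1 - H/2)}`. -/
noncomputable def rosFamily (H σ y : ℝ) : ℝ := (max 0 (σ - y)) ^ (-(1 - H / 2))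

lemma rosFamily_nonneg (H σ y : ℝ) : 0 ≤ rosFamily H σ y :=
  Real.rpow_nonneg (le_max_left _ _) _

lemma measurable_rosFamily (H : ℝ) : Measurable (Function.uncurry (rosFamily H)) := by
  unfold rosFamily Function.uncurry
  fun_prop

/-- Near `0` the integrand is at most `u^(-(1-H/2))`, integrable as `H > 0`; at infinity at most
`u^(H-2)`, integrable as `H < 1`. -/
lemma integrable_rosFamily_mul {H : ℝ} (h0 : 0 < H) (h1 : H < 1) :
    Integrable (fun u => rosFamily H u 0 * rosFamily H (1 + u) 0) := by
  have ha : -(1 - H / 2) ≠ 0 := by linarith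
  have hm : Measurable fun u => rosFamily H u 0 * rosFamily H (1 + u) 0 := by
    unfold rosFamily; fun_prop
  rw [← integrableOn_univ, ← Set.Iic_union_Ioi (a := (0 : ℝ)), integrableOn_union,
    ← Set.Ioc_union_Ioi_eq_Ioi (zero_le_one' ℝ), integrableOn_union]
  refine ⟨?_, ?_, ?_⟩
  · refine integrableOn_zero.congr_fun (fun u hu => ?_) measurableSet_Iic
    have : max 0 (u - 0) = 0 := max_eq_left (by simpa using hu)
    simp only [rosFamily, this, Real.zero_rpow ha, zero_mul]
  · have h := (intervalIntegral.intervalIntegrable_rpow' (a := 0) (b := 1)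
      (r := -(1 - H / 2)) (by linarith)).1
    refine h.mono' hm.aestronglyMeasurable ?_
    filter_upwards [ae_restrict_mem measurableSet_Ioc] with u hu
    have e1 : max 0 (u - 0) = u := by rw [sub_zero]; exact max_eq_right hu.1.le
    have e2 : max 0 (1 + u - 0) = 1 + u := by rw [sub_zero]; exact max_eq_right (by linarith [hu.1])
    rw [Real.norm_of_nonneg (mul_nonneg (rosFamily_nonneg _ _ _) (rosFamily_nonneg _ _ _))]
    simp only [rosFamily, e1, e2]
    refine mul_le_of_le_one_right (Real.rpow_nonneg hu.1.le _) ?_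
    exact Real.rpow_le_one_of_one_le_of_nonpos (by linarith [hu.1]) (by linarith)
  · have h := integrableOn_Ioi_rpow_of_lt (a := -(1 - H / 2) + -(1 - H / 2)) (by linarith)
      (zero_lt_one' ℝ)
    refine h.mono' hm.aestronglyMeasurable ?_
    filter_upwards [ae_restrict_mem measurableSet_Ioi] with u hu
    have hu0 : 0 < u := lt_trans zero_lt_one hu
    have e1 : max 0 (u - 0) = u := by rw [sub_zero]; exact max_eq_right hu0.le
    have e2 : max 0 (1 + u - 0) = 1 + u := by rw [sub_zero]; exact max_eq_right (by linarith)
    rw [Real.norm_of_nonneg (mul_nonneg (rosFamily_nonneg _ _ _) (rosFamily_nonneg _ _ _)),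
      Real.rpow_add hu0]
    simp only [rosFamily, e1, e2]
    refine mul_le_mul_of_nonneg_left ?_ (Real.rpow_nonneg hu0.le _)
    exact Real.rpow_le_rpow_of_nonpos hu0 (by linarith) (by linarith)

lemma integral_rosFamily_mul_pos {H : ℝ} (h0 : 0 < H) (h1 : H < 1) :
    0 < ∫ u, rosFamily H u 0 * rosFamily H (1 + u) 0 := by
  rw [integral_pos_iff_support_of_nonneg
    (fun u => mul_nonneg (rosFamily_nonneg _ _ _) (rosFamily_nonneg _ _ _))
    (integrable_rosFamily_mul h0 h1)]
  refine lt_of_lt_of_le ?_ (measure_mono (s := Set.Ioi 0) fun u hu => ?_)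
  · simp
  · have hu0 : (0 : ℝ) < u := hu
    have e1 : max 0 (u - 0) = u := by rw [sub_zero]; exact max_eq_right hu0.le
    have e2 : max 0 (1 + u - 0) = 1 + u := by rw [sub_zero]; exact max_eq_right (by linarith)
    simp only [Function.mem_support, rosFamily, e1, e2]
    have := Real.rpow_pos_of_pos hu0 (-(1 - H / 2))
    have := Real.rpow_pos_of_pos (by linarith : (0 : ℝ) < 1 + u) (-(1 - H / 2))
    positivity

/-- Homogeneity under `u = (σ - y) / (τ - σ)`: the two factors contribute the power `H - 2`, and the
Jacobian later raises it to `H - 1`. -/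
lemma rosFamily_mul_scale (H : ℝ) {σ τ : ℝ} (h : σ < τ) (y : ℝ) :
    rosFamily H σ y * rosFamily H τ y = (τ - σ) ^ (H - 2) *
      (rosFamily H ((σ - y) / (τ - σ)) 0 * rosFamily H (1 + (σ - y) / (τ - σ)) 0) := by
  have hd : 0 < τ - σ := sub_pos.2 h
  have e1 : max 0 (σ - y) = (τ - σ) * max 0 ((σ - y) / (τ - σ) - 0) := by
    rw [mul_max_of_nonneg _ _ hd.le, mul_zero, sub_zero, mul_div_cancel₀ _ hd.ne']
  have e2 : max 0 (τ - y) = (τ - σ) * max 0 (1 + (σ - y) / (τ - σ) - 0) := by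
    rw [mul_max_of_nonneg _ _ hd.le, mul_zero, sub_zero, mul_add, mul_div_cancel₀ _ hd.ne']
    congr 1; ring
  simp only [rosFamily]
  rw [e1, e2, Real.mul_rpow hd.le (le_max_left _ _), Real.mul_rpow hd.le (le_max_left _ _),
    show H - 2 = -(1 - H / 2) + -(1 - H / 2) by ring, Real.rpow_add hd]
  ring

lemma hasPowerGram_rosFamily {H : ℝ} (h0 : 0 < H) (h1 : H < 1) :
    HasPowerGram volume (rosFamily H) H (∫ u, rosFamily H u 0 * rosFamily H (1 + u) 0) := by
  have hI := integrable_rosFamily_mul h0 h1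
  refine .of_lt (measurable_rosFamily H) (rosFamily_nonneg H) (fun σ τ h => ?_) fun σ τ h => ?_
  · have hd : 0 < τ - σ := sub_pos.2 h
    simp_rw [rosFamily_mul_scale H h]
    exact (((hI.comp_div hd.ne').comp_sub_left σ)).const_mul _
  · have hd : 0 < τ - σ := sub_pos.2 h
    simp_rw [rosFamily_mul_scale H h]
    rw [integral_const_mul, integral_sub_left_eq_self (fun v =>
      rosFamily H (v / (τ - σ)) 0 * rosFamily H (1 + v / (τ - σ)) 0) volume σ,
      Measure.integral_comp_div (fun v => rosFamily H v 0 * rosFamily H (1 + v) 0),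
      abs_of_pos hd, smul_eq_mul, ← mul_assoc, ← Real.rpow_add_one hd.ne', mul_comm]
    congr 2; ring

end Rosenblatt

/-! ### The Gram kernel of the family whose tensor square is `E_∞`. -/

section Heat

lemma hurstIndex_eq (α β : ℝ) : hurstIndex α β = (α + 2 * β - 1) / (2 * β) := by
  unfold hurstIndex scalingExponent
  rw [mul_div_assoc', one_div_div]

variable {d : ℕ}

/-- The family `σ ↦ 1_{s ≤ σ} (a₀ r₀)^{1/2} |k|^{-γ} exp(-(r₀/2) |k|^{2β} |σ - s|)` with
`γ = (α + d - 1) / 2 - β`, whose tensor square is `E_∞`. -/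
noncomputable def heatFamily (a₀ r₀ α β : ℝ) (σ : ℝ) (p : ℝ × EuclideanSpace ℝ (Fin d)) : ℝ :=
  if p.1 ≤ σ then √(a₀ * r₀) * (‖p.2‖⁻¹) ^ ((α + d - 1) / 2 - β) *
    Real.exp (-(r₀ / 2) * (‖p.2‖ ^ (2 * β) * |σ - p.1|)) else 0

lemma heatFamily_nonneg (a₀ r₀ α β σ : ℝ) (p : ℝ × EuclideanSpace ℝ (Fin d)) :
    0 ≤ heatFamily a₀ r₀ α β σ p := by
  unfold heatFamily
  split_ifs <;> positivity

lemma measurable_heatFamily (a₀ r₀ α β : ℝ) :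
    Measurable (Function.uncurry (heatFamily (d := d) a₀ r₀ α β)) := by
  unfold heatFamily Function.uncurry
  refine Measurable.ite (measurableSet_le (by fun_prop) (by fun_prop)) ?_ measurable_const
  fun_prop

lemma heatFamily_flipK (a₀ r₀ α β σ : ℝ) (p : ℝ × EuclideanSpace ℝ (Fin d)) :
    heatFamily a₀ r₀ α β σ (flipK d p) = heatFamily a₀ r₀ α β σ p := by
  simp [heatFamily, flipK]

lemma heatFamily_mul {a₀ r₀ : ℝ} (ha₀ : 0 < a₀) (hr₀ : 0 < r₀) (α β σ : ℝ)
    (p q : ℝ × EuclideanSpace ℝ (Fin d)) :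
    heatFamily a₀ r₀ α β σ p * heatFamily a₀ r₀ α β σ q =
      if p.1 ≤ σ ∧ q.1 ≤ σ then Einf a₀ r₀ α β (σ - p.1) (σ - q.1) p.2 q.2 else 0 := by
  unfold heatFamily Einf
  by_cases h1 : p.1 ≤ σ
  · by_cases h2 : q.1 ≤ σ
    · rw [if_pos h1, if_pos h2, if_pos ⟨h1, h2⟩, mul_add, Real.exp_add, one_div, mul_inv,
        Real.mul_rpow (by positivity) (by positivity)]
      linear_combination (‖p.2‖⁻¹ ^ ((α + d - 1) / 2 - β) * ‖q.2‖⁻¹ ^ ((α + d - 1) / 2 - β) *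
        (Real.exp (-(r₀ / 2) * (‖p.2‖ ^ (2 * β) * |σ - p.1|)) *
          Real.exp (-(r₀ / 2) * (‖q.2‖ ^ (2 * β) * |σ - q.1|)))) *
        Real.mul_self_sqrt (mul_pos ha₀ hr₀).le
    · simp [h2]
  · simp [h1]

/-- The integrand of the spatial Gram kernel of `heatFamily`. -/
noncomputable def spatialGram (d : ℕ) (r₀ α β h : ℝ) (k : EuclideanSpace ℝ (Fin d)) : ℝ :=
  ‖k‖ ^ (-(α + d - 1)) * Real.exp (-(r₀ / 2 * h) * ‖k‖ ^ (2 * β))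

lemma spatialGram_nonneg (r₀ α β h : ℝ) (k : EuclideanSpace ℝ (Fin d)) :
    0 ≤ spatialGram d r₀ α β h k := by
  unfold spatialGram; positivity

/-- In polar coordinates the Jacobian `u^(d-1)` reduces the power to `u^(-α)`, integrable at the
origin because `α < 1`; the exponential handles infinity. -/
lemma integrable_spatialGram (hd : 1 ≤ d) {r₀ α β h : ℝ} (hr₀ : 0 < r₀) (hβ : 0 < β)
    (hα : α < 1) (hh : 0 < h) : Integrable (spatialGram d r₀ α β h) := by
  have : Nontrivial (EuclideanSpace ℝ (Fin d)) :=
    Module.nontrivial_of_finrank_pos (R := ℝ) (by rw [finrank_euclideanSpace_fin]; omega)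
  unfold spatialGram
  rw [integrable_fun_norm_addHaar volume
    (f := fun u => u ^ (-(α + d - 1)) * Real.exp (-(r₀ / 2 * h) * u ^ (2 * β)))]
  refine (integrableOn_rpow_mul_exp_neg_mul_rpow (p := 2 * β) (s := -α) (b := r₀ / 2 * h)
    (by linarith) (by linarith) (by positivity)).congr_fun (fun u hu => ?_) measurableSet_Ioi
  have hu0 : (0 : ℝ) < u := hu
  rw [finrank_euclideanSpace_fin, smul_eq_mul, ← mul_assoc, ← Real.rpow_natCast,
    ← Real.rpow_add hu0, Nat.cast_sub hd, Nat.cast_one,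
    show (d : ℝ) - 1 + -(α + d - 1) = -α by ring]

lemma integral_spatialGram_pos (hd : 1 ≤ d) {r₀ α β h : ℝ} (hr₀ : 0 < r₀) (hβ : 0 < β)
    (hα : α < 1) (hh : 0 < h) : 0 < ∫ k, spatialGram d r₀ α β h k := by
  have : Nontrivial (EuclideanSpace ℝ (Fin d)) :=
    Module.nontrivial_of_finrank_pos (R := ℝ) (by rw [finrank_euclideanSpace_fin]; omega)
  rw [integral_pos_iff_support_of_nonneg (spatialGram_nonneg r₀ α β h)
    (integrable_spatialGram hd hr₀ hβ hα hh)]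
  refine lt_of_lt_of_le ?_ (measure_mono (s := {0}ᶜ) fun k hk => ?_)
  · obtain ⟨x, hx⟩ := exists_ne (0 : EuclideanSpace ℝ (Fin d))
    exact isOpen_compl_singleton.measure_pos _ ⟨x, hx⟩
  · have hk0 : 0 < ‖k‖ := norm_pos_iff.2 hk
    simp only [Function.mem_support, spatialGram]
    have := Real.rpow_pos_of_pos hk0 (-(α + d - 1))
    positivity

/-- Dilate `k` by `R = h^(1/(2β))`, chosen so that `R^(2β)` absorbs `h` in the exponential. The
exponent obtained is `hurstIndex α β - 1`. -/
lemma integral_spatialGram_scale {r₀ α β h : ℝ} (hβ : 0 < β) (hh : 0 < h) :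
    ∫ k, spatialGram d r₀ α β h k =
      h ^ ((α - 1) / (2 * β)) * ∫ k, spatialGram d r₀ α β 1 k := by
  set R := h ^ (1 / (2 * β)) with hR
  have hR0 : 0 < R := Real.rpow_pos_of_pos hh _
  have hRβ : R ^ (2 * β) = h := by
    rw [hR, ← Real.rpow_mul hh.le, one_div_mul_cancel (by positivity), Real.rpow_one]
  have hs : ∀ k, spatialGram d r₀ α β 1 (R • k) =
      R ^ (-(α + d - 1)) * spatialGram d r₀ α β h k := fun k => by
    simp only [spatialGram]
    rw [norm_smul, Real.norm_of_nonneg hR0.le, Real.mul_rpow hR0.le (norm_nonneg _),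
      Real.mul_rpow hR0.le (norm_nonneg _), hRβ, mul_assoc]
    congr 3; ring
  have h1 := Measure.integral_comp_smul (volume : Measure (EuclideanSpace ℝ (Fin d)))
    (spatialGram d r₀ α β 1) R
  simp_rw [hs] at h1
  rw [integral_const_mul, finrank_euclideanSpace_fin, smul_eq_mul,
    abs_of_pos (by positivity), ← Real.rpow_natCast, ← Real.rpow_neg hR0.le] at h1
  have h2 : ∫ k, spatialGram d r₀ α β h k =
      R ^ (α - 1) * ∫ k, spatialGram d r₀ α β 1 k := by
    have h3 : R ^ (α + d - 1) * R ^ (-(α + d - 1)) = 1 := by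
      rw [← Real.rpow_add hR0, add_neg_cancel, Real.rpow_zero]
    have h4 : R ^ (α + d - 1) * R ^ (-(d : ℝ)) = R ^ (α - 1) := by
      rw [← Real.rpow_add hR0]; congr 1; ring
    rw [← h4, mul_assoc, ← h1, ← mul_assoc, h3, one_mul]
  rw [h2, hR, ← Real.rpow_mul hh.le]
  congr 2; ring

/-- The integrand is a multiple of `exp (A s)` on `s ≤ σ`, with `A = r₀ |k|^(2β)`. Dividing by `A`
cancels `r₀` and the extra `|k|^(2β)` from the two prefactors. -/
lemma lintegral_heatFamily_time {a₀ r₀ α β : ℝ} (ha₀ : 0 < a₀) (hr₀ : 0 < r₀)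
    {σ τ : ℝ} (h : σ < τ) {k : EuclideanSpace ℝ (Fin d)} (hk : k ≠ 0) :
    ∫⁻ s, ENNReal.ofReal (heatFamily a₀ r₀ α β σ (s, k)) *
      ENNReal.ofReal (heatFamily a₀ r₀ α β τ (s, k)) =
      ENNReal.ofReal (a₀ * spatialGram d r₀ α β (τ - σ) k) := by
  have hk0 : 0 < ‖k‖ := norm_pos_iff.2 hk
  set A := r₀ * ‖k‖ ^ (2 * β) with hA
  have hA0 : 0 < A := mul_pos hr₀ (Real.rpow_pos_of_pos hk0 _)
  set K := a₀ * r₀ * (‖k‖ ^ (-(α + d - 1)) * ‖k‖ ^ (2 * β)) * Real.exp (-(A / 2) * (σ + τ)) with hK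
  have hK0 : 0 ≤ K := by positivity
  have hprod : ∀ s, ENNReal.ofReal (heatFamily a₀ r₀ α β σ (s, k)) *
      ENNReal.ofReal (heatFamily a₀ r₀ α β τ (s, k)) =
      (Set.Iic σ).indicator (fun s => ENNReal.ofReal (K * Real.exp (A * s))) s := by
    intro s
    rw [← ENNReal.ofReal_mul (heatFamily_nonneg _ _ _ _ _ _)]
    by_cases hs : s ≤ σ
    · rw [Set.indicator_of_mem (by exact hs)]
      congr 1
      simp only [heatFamily]
      rw [if_pos hs, if_pos (hs.trans h.le), abs_of_nonneg (by linarith), abs_of_nonneg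
        (by linarith), hK]
      have e1 : (‖k‖⁻¹ : ℝ) ^ ((α + d - 1) / 2 - β) * (‖k‖⁻¹) ^ ((α + d - 1) / 2 - β) =
          ‖k‖ ^ (-(α + d - 1)) * ‖k‖ ^ (2 * β) := by
        rw [← Real.rpow_add hk0, ← Real.rpow_add (inv_pos.2 hk0), Real.inv_rpow hk0.le,
          ← Real.rpow_neg hk0.le]
        congr 1; ring
      have e2 : Real.exp (-(r₀ / 2) * (‖k‖ ^ (2 * β) * (σ - s))) *
          Real.exp (-(r₀ / 2) * (‖k‖ ^ (2 * β) * (τ - s))) =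
          Real.exp (-(A / 2) * (σ + τ)) * Real.exp (A * s) := by
        rw [← Real.exp_add, ← Real.exp_add, hA]; congr 1; ring
      have e3 := Real.mul_self_sqrt (mul_pos ha₀ hr₀).le
      calc _ = (√(a₀ * r₀) * √(a₀ * r₀)) *
            ((‖k‖⁻¹ : ℝ) ^ ((α + d - 1) / 2 - β) * (‖k‖⁻¹) ^ ((α + d - 1) / 2 - β)) *
            (Real.exp (-(r₀ / 2) * (‖k‖ ^ (2 * β) * (σ - s))) *
              Real.exp (-(r₀ / 2) * (‖k‖ ^ (2 * β) * (τ - s)))) := by ring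
        _ = _ := by rw [e1, e2, e3]; ring
    · rw [Set.indicator_of_notMem (by exact hs)]
      simp [heatFamily, hs]
  simp_rw [hprod]
  rw [lintegral_indicator measurableSet_Iic, ← ofReal_integral_eq_lintegral_ofReal
    ((integrableOn_exp_mul_Iic hA0 σ).const_mul K) (ae_of_all _ fun s => by positivity),
    integral_const_mul, integral_exp_mul_Iic hA0]
  congr 1
  have e4 : Real.exp (-(A / 2) * (σ + τ)) * Real.exp (A * σ) =
      Real.exp (-(r₀ / 2 * (τ - σ)) * ‖k‖ ^ (2 * β)) := by
    rw [← Real.exp_add, hA]; congr 1; ring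
  rw [hK, spatialGram, ← e4, hA]
  have := (Real.rpow_pos_of_pos hk0 (2 * β)).ne'
  field_simp

lemma hasPowerGram_heatFamily (hd : 1 ≤ d) {a₀ r₀ α β : ℝ} (ha₀ : 0 < a₀) (hr₀ : 0 < r₀)
    (hβ : 0 < β) (hα : α < 1) :
    HasPowerGram volume (heatFamily (d := d) a₀ r₀ α β) (hurstIndex α β)
      (a₀ * ∫ k, spatialGram d r₀ α β 1 k) := by
  have hne : ∀ᵐ k : EuclideanSpace ℝ (Fin d), k ≠ 0 := by
    have : Nontrivial (EuclideanSpace ℝ (Fin d)) :=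
      Module.nontrivial_of_finrank_pos (R := ℝ) (by rw [finrank_euclideanSpace_fin]; omega)
    exact Measure.ae_ne volume 0
  have hm : Measurable (Function.uncurry fun σ x =>
      ENNReal.ofReal (heatFamily (d := d) a₀ r₀ α β σ x)) :=
    (measurable_heatFamily (d := d) a₀ r₀ α β).ennreal_ofReal
  refine .of_gram_lt (measurable_heatFamily _ _ _ _) (heatFamily_nonneg _ _ _ _) fun σ τ h => ?_
  · have hh : 0 < τ - σ := sub_pos.2 h
    rw [gram, Measure.volume_eq_prod, lintegral_prod_symm]
    · rw [lintegral_congr_ae (g := fun k => ENNReal.ofReal (a₀ * spatialGram d r₀ α β (τ - σ) k))]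
      · rw [← ofReal_integral_eq_lintegral_ofReal
          ((integrable_spatialGram hd hr₀ hβ hα hh).const_mul a₀)
          (ae_of_all _ fun k => mul_nonneg ha₀.le (spatialGram_nonneg _ _ _ _ _)),
          integral_const_mul, integral_spatialGram_scale hβ hh]
        congr 1
        have : hurstIndex α β - 1 = (α - 1) / (2 * β) := by
          rw [hurstIndex_eq]
          field_simp; ring
        rw [this]; ring
      · filter_upwards [hne] with k hk
        exact lintegral_heatFamily_time ha₀ hr₀ h hk
    · exact ((measurable_family hm σ).mul (measurable_family hm τ)).aemeasurable

end Heat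

/-! ### Averages of a family over bounded sets, as elements of `L²`. -/

section SymmetricFamilies

/-- The function `∫_S G_σ dσ` for a family of nonnegative real functions. -/
noncomputable def setFun {X : Type*} (G : ℝ → X → ℝ) (S : Set ℝ) (x : X) : ℝ :=
  (setIntegral (fun σ x => ENNReal.ofReal (G σ x)) S x).toReal

/-- Subsets of bounded intervals of the half line. -/
abbrev BddSet : Type := {S : Set ℝ // ∃ T, S ⊆ Set.Ioc 0 T}

variable {X : Type*} [MeasurableSpace X] {μ : Measure X} {G : ℝ → X → ℝ} {H C : ℝ}

lemma HasPowerGram.measurable_setFun (hG : HasPowerGram μ G H C) (S : Set ℝ) :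
    Measurable (setFun G S) :=
  (measurable_setIntegral hG.measurable_ofReal S).ennreal_toReal

variable [SFinite μ] (hG : HasPowerGram μ G H C) (hH : 1 / 2 < H)
include hG hH

omit [SFinite μ] in
lemma HasPowerGram.lintegral_gram_ne_top (S S' : BddSet) :
    ∫⁻ σ in S.1, ∫⁻ τ in S'.1, gram μ (fun σ x => ENNReal.ofReal (G σ x)) σ τ ≠ ∞ := by
  obtain ⟨S, T, hS⟩ := S
  obtain ⟨S', T', hS'⟩ := S'
  refine ChaosProcess.lintegral_gram_ne_top (T := Set.Ioc 0 (max T T')) (by simp)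
    (hS.trans (Set.Ioc_subset_Ioc_right (le_max_left _ _)))
    (hS'.trans (Set.Ioc_subset_Ioc_right (le_max_right _ _)))
    (hG.lintegral_gram_sq_ne_top hH _)

lemma HasPowerGram.lintegral_setIntegral_sq_ne_top (S : BddSet) :
    ∫⁻ x, setIntegral (fun σ x => ENNReal.ofReal (G σ x)) S.1 x ^ 2 ∂μ ≠ ∞ := by
  simp_rw [sq, lintegral_setIntegral_mul_setIntegral hG.measurable_ofReal]
  exact hG.lintegral_gram_ne_top hH S S

lemma HasPowerGram.setIntegral_ae_ne_top (S : BddSet) :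
    ∀ᵐ x ∂μ, setIntegral (fun σ x => ENNReal.ofReal (G σ x)) S.1 x ≠ ∞ :=
  ae_ne_top_of_lintegral_sq (measurable_setIntegral hG.measurable_ofReal _)
    (hG.lintegral_setIntegral_sq_ne_top hH S)

lemma HasPowerGram.memLp_setFun (S : BddSet) : MemLp (setFun G S.1) 2 μ := by
  refine ⟨(hG.measurable_setFun S.1).aestronglyMeasurable, ?_⟩
  rw [eLpNorm_lt_top_iff_lintegral_rpow_enorm_lt_top (by norm_num) (by norm_num)]
  refine lt_of_le_of_lt (lintegral_mono fun x => ?_)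
    (hG.lintegral_setIntegral_sq_ne_top hH S).lt_top
  simp only [ENNReal.toReal_ofNat, ENNReal.rpow_ofNat]
  gcongr
  rw [setFun, Real.enorm_of_nonneg ENNReal.toReal_nonneg]
  exact ENNReal.ofReal_toReal_le

/-- The right side involves only `H` and `C`, so averages of two families with the same parameters
have the same Gram matrix. The diagonal, where `gram` is unspecified, is null. -/
lemma HasPowerGram.inner_setFun (S S' : BddSet) :
    inner ℝ ((hG.memLp_setFun hH S).toLp _) ((hG.memLp_setFun hH S').toLp _) =
      (∫⁻ σ in S.1, ∫⁻ τ in S'.1, ENNReal.ofReal (C * |σ - τ| ^ (H - 1))).toReal := by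
  have hgram : ∫⁻ σ in S.1, ∫⁻ τ in S'.1, ENNReal.ofReal (C * |σ - τ| ^ (H - 1)) =
      ∫⁻ σ in S.1, ∫⁻ τ in S'.1, gram μ (fun σ x => ENNReal.ofReal (G σ x)) σ τ := by
    refine lintegral_congr fun σ => lintegral_congr_ae ?_
    filter_upwards [ae_restrict_of_ae (Measure.ae_ne volume σ)] with τ hτ
    rw [hG.gram_eq σ τ hτ.symm]
  have hm := fun S : BddSet => measurable_setIntegral hG.measurable_ofReal S.1
  rw [hgram, ← lintegral_setIntegral_mul_setIntegral hG.measurable_ofReal, L2.inner_def]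
  rw [← integral_toReal (f := fun x => setIntegral (fun σ x => ENNReal.ofReal (G σ x)) S.1 x *
    setIntegral (fun σ x => ENNReal.ofReal (G σ x)) S'.1 x) ((hm S).mul (hm S')).aemeasurable]
  · refine integral_congr_ae ?_
    filter_upwards [(hG.memLp_setFun hH S).coeFn_toLp, (hG.memLp_setFun hH S').coeFn_toLp]
      with x h1 h2
    rw [h1, h2, ENNReal.toReal_mul]
    simp [setFun, mul_comm]
  · filter_upwards [hG.setIntegral_ae_ne_top hH S, hG.setIntegral_ae_ne_top hH S'] with x h1 h2
    exact ENNReal.mul_lt_top h1.lt_top h2.lt_top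

omit [SFinite μ] hH in
lemma HasPowerGram.integral_mul_eq_toReal {t : ℝ} (ht : 0 ≤ t) (p : X × X) :
    ∫ σ in (0 : ℝ)..t, G σ p.1 * G σ p.2 =
      (diagKernel (fun σ x => ENNReal.ofReal (G σ x)) (Set.Ioc 0 t) p).toReal := by
  rw [intervalIntegral.integral_of_le ht, integral_eq_lintegral_of_nonneg_ae
    (ae_of_all _ fun σ => mul_nonneg (hG.nonneg _ _) (hG.nonneg _ _)), diagKernel]
  · simp only [ENNReal.ofReal_mul (hG.nonneg _ _)]
  · refine Measurable.aestronglyMeasurable ?_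
    exact (hG.measurable.comp (measurable_id.prodMk measurable_const)).mul
      (hG.measurable.comp (measurable_id.prodMk measurable_const))

lemma HasPowerGram.memLp_diagKernel (t : ℝ) :
    MemLp (fun p => (((diagKernel (fun σ x => ENNReal.ofReal (G σ x)) (Set.Ioc 0 t) p).toReal : ℝ)
      : ℂ)) 2 (μ.prod μ) := by
  refine MemLp.ofReal (K := ℂ) (f := fun p =>
    (diagKernel (fun σ x => ENNReal.ofReal (G σ x)) (Set.Ioc 0 t) p).toReal) ?_
  have hm := measurable_diagKernel hG.measurable_ofReal (Set.Ioc 0 t)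
  refine ⟨hm.ennreal_toReal.aestronglyMeasurable, ?_⟩
  rw [eLpNorm_lt_top_iff_lintegral_rpow_enorm_lt_top (by norm_num) (by norm_num)]
  have hfin := hG.lintegral_gram_sq_ne_top hH t
  rw [← lintegral_diagKernel_sq hG.measurable_ofReal] at hfin
  refine lt_of_le_of_lt (lintegral_mono fun x => ?_) hfin.lt_top
  simp only [ENNReal.toReal_ofNat, ENNReal.rpow_ofNat]
  gcongr
  rw [Real.enorm_of_nonneg ENNReal.toReal_nonneg]
  exact ENNReal.ofReal_toReal_le

end SymmetricFamilies

/-! ### Cell averages as elementary kernels. -/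

section CellLists

/-- The `i`-th cell of a partition of `(0, t]`, as a bounded set. -/
def bddCell (t : ℝ≥0) {n i : ℕ} (hi : i < n) : BddSet :=
  ⟨cell t n i, t, by
    rcases eq_or_lt_of_le t.2 with h | h
    · have h0 : (t : ℝ) = 0 := h.symm
      simp [cell, h0]
    · exact cell_subset h hi⟩

/-- The multiple `w ∫_S G_σ dσ`, as an element of `L²_(s)`. -/
noncomputable def HasPowerGram.toSymm {E : Type*} [MeasureSpace E] [SFinite (volume : Measure E)]
    {τ : E → E} {G : ℝ → E → ℝ} {H C : ℝ} (hG : HasPowerGram volume G H C) (hH : 1 / 2 < H)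
    (hs : ∀ σ x, G σ (τ x) = G σ x) (S : BddSet) (w : ℝ) : SymmL2 τ :=
  ⟨fun x => ((w * setFun G S.1 x : ℝ) : ℂ), ((hG.memLp_setFun hH S).const_mul w).ofReal,
    ae_of_all _ fun x => by
      rw [Complex.conj_ofReal]
      simp only [setFun, setIntegral, hs]⟩

/-- The list of pairs representing the averaged kernel over a partition of `(0, t]`. -/
noncomputable def HasPowerGram.cellList {E : Type*} [MeasureSpace E]
    [SFinite (volume : Measure E)] {τ : E → E} {G : ℝ → E → ℝ} {H C : ℝ}
    (hG : HasPowerGram volume G H C) (hH : 1 / 2 < H)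
    (hs : ∀ σ x, G σ (τ x) = G σ x) (t : ℝ≥0) (n : ℕ) : List (SymmL2 τ × SymmL2 τ) :=
  List.ofFn fun i : Fin n =>
    -- The weight `n / t` sits in the first test function, since lists carry no coefficients. For `t
    -- = 0` it is `0` and the cells are empty, as they should be.
    (hG.toSymm hH hs (bddCell t i.2) (n / t), hG.toSymm hH hs (bddCell t i.2) 1)

variable {E : Type*} [MeasureSpace E] [SFinite (volume : Measure E)] {τ : E → E} {G : ℝ → E → ℝ}
  {H C : ℝ} (hG : HasPowerGram volume G H C) (hH : 1 / 2 < H) (hs : ∀ σ x, G σ (τ x) = G σ x)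
include hG hH hs

lemma HasPowerGram.elemKernel_cellList (t : ℝ≥0) (n : ℕ) :
    ∀ᵐ p ∂((volume : Measure E).prod volume), elemKernel (hG.cellList hH hs t n) p =
      (((cellKernel (fun σ x => ENNReal.ofReal (G σ x)) t n p).toReal : ℝ) : ℂ) := by
  have h1 : ∀ᵐ p ∂((volume : Measure E).prod (volume : Measure E)), ∀ i : Fin n,
      setIntegral (fun σ x => ENNReal.ofReal (G σ x)) (cell t n i) p.1 ≠ ∞ :=
    ae_all_iff.2 fun i => Measure.quasiMeasurePreserving_fst.ae
      (hG.setIntegral_ae_ne_top hH (bddCell t i.2))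
  have h2 : ∀ᵐ p ∂((volume : Measure E).prod (volume : Measure E)), ∀ i : Fin n,
      setIntegral (fun σ x => ENNReal.ofReal (G σ x)) (cell t n i) p.2 ≠ ∞ :=
    ae_all_iff.2 fun i => Measure.quasiMeasurePreserving_snd.ae
      (hG.setIntegral_ae_ne_top hH (bddCell t i.2))
  filter_upwards [h1, h2] with p h1 h2
  rw [elemKernel, HasPowerGram.cellList, List.map_ofFn, List.sum_ofFn, cellKernel,
    Finset.sum_range, ENNReal.toReal_sum, Complex.ofReal_sum]
  · refine Finset.sum_congr rfl fun i _ => ?_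
    rw [ENNReal.toReal_mul, ENNReal.toReal_mul, ENNReal.toReal_ofReal (by positivity)]
    simp only [Function.comp_apply, HasPowerGram.toSymm, setFun, bddCell]
    push_cast
    ring
  · exact fun i _ => ENNReal.mul_ne_top (by simp) (ENNReal.mul_ne_top (h1 i) (h2 i))

lemma HasPowerGram.tendsto_elemKernel_cellList (t : ℝ≥0) :
    Tendsto (fun n => eLpNorm (fun p => ((∫ σ in (0 : ℝ)..t, G σ p.1 * G σ p.2 : ℝ) : ℂ) -
      elemKernel (hG.cellList hH hs t n) p) 2 ((volume : Measure E).prod volume))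
      atTop (𝓝 0) := by
  have hlim : Tendsto (fun n => ∫⁻ p, ‖(diagKernel (fun σ x => ENNReal.ofReal (G σ x))
      (Set.Ioc 0 (t : ℝ)) p).toReal - (cellKernel (fun σ x => ENNReal.ofReal (G σ x)) t n p).toReal‖ₑ
        ^ 2 ∂((volume : Measure E).prod volume)) atTop (𝓝 0) := by
    rcases eq_or_lt_of_le t.2 with h | h
    · have h0 : (t : ℝ) = 0 := h.symm
      simp [h0, diagKernel, cellKernel]
    · exact tendsto_lintegral_diagKernel_sub_cellKernel hG.measurable_ofReal h hG.continuousAt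
        (hG.lintegral_gram_sq_ne_top hH t)
  have hroot := (ENNReal.continuous_rpow_const (y := 1 / 2)).tendsto 0 |>.comp hlim
  rw [ENNReal.zero_rpow_of_pos (by norm_num)] at hroot
  refine hroot.congr fun n => ?_
  rw [eLpNorm_eq_lintegral_rpow_enorm_toReal (by norm_num) (by norm_num)]
  simp only [Function.comp_apply, ENNReal.toReal_ofNat, ENNReal.rpow_ofNat]
  congr 1
  refine lintegral_congr_ae ?_
  filter_upwards [hG.elemKernel_cellList hH hs t n] with p hp
  rw [hp, hG.integral_mul_eq_toReal t.coe_nonneg, ← Complex.ofReal_sub]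
  congr 1
  rw [← ofReal_norm, ← ofReal_norm, Complex.norm_real]

omit hs in
lemma HasPowerGram.memLp_kernel (t : ℝ≥0) :
    MemLp (fun p => ((∫ σ in (0 : ℝ)..t, G σ p.1 * G σ p.2 : ℝ) : ℂ)) 2
      ((volume : Measure E).prod volume) := by
  simp_rw [hG.integral_mul_eq_toReal t.coe_nonneg]
  exact hG.memLp_diagKernel hH t

end CellLists

/-! ### Extending an isometry from a closed span. -/

section HilbertExtension

variable {K₁ K₂ K₃ : Type*} [NormedAddCommGroup K₁] [InnerProductSpace ℝ K₁] [CompleteSpace K₁]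
  [NormedAddCommGroup K₂] [InnerProductSpace ℝ K₂] [CompleteSpace K₂]
  [NormedAddCommGroup K₃] [InnerProductSpace ℝ K₃]

omit [CompleteSpace K₁] [CompleteSpace K₂] in
lemma inner_linearCombination_eq {ι : Type*} {v : ι → K₁} {w : ι → K₂}
    (h : ∀ i j, inner ℝ (v i) (v j) = inner ℝ (w i) (w j)) (x y : ι →₀ ℝ) :
    inner ℝ (Finsupp.linearCombination ℝ w x) (Finsupp.linearCombination ℝ w y) =
      inner ℝ (Finsupp.linearCombination ℝ v x) (Finsupp.linearCombination ℝ v y) := by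
  simp only [Finsupp.linearCombination_apply, Finsupp.sum_inner, Finsupp.inner_sum, h,
    inner_smul_left, inner_smul_right]

/-- Two families with the same Gram matrix are related by an isometry of the closures of their
spans; it extends to the whole space by any isometry `V` into a third space. -/
lemma exists_isometric_pair {ι : Type*} {v : ι → K₁} {w : ι → K₂}
    (h : ∀ i j, inner ℝ (v i) (v j) = inner ℝ (w i) (w j)) (V : K₁ →ₗᵢ[ℝ] K₃) :
    ∃ (U₁ : K₁ →L[ℝ] K₂) (U₂ : K₁ →L[ℝ] K₁),
      (∀ x y, inner ℝ (U₁ x) (U₁ y) + inner ℝ (V (U₂ x)) (V (U₂ y)) = inner ℝ x y) ∧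
      (∀ i, U₁ (v i) = w i) ∧ (∀ i, U₂ (v i) = 0) ∧
      ∀ x, U₁ x ∈ (Submodule.span ℝ (Set.range w)).topologicalClosure := by
  set M := (Submodule.span ℝ (Set.range v)).topologicalClosure with hM
  have hcomplete : CompleteSpace M :=
    (Submodule.isClosed_topologicalClosure _).completeSpace_coe
  have hmem : ∀ x : ι →₀ ℝ, Finsupp.linearCombination ℝ v x ∈ M := fun x =>
    Submodule.le_topologicalClosure _ (Finsupp.mem_span_range_iff_exists_finsupp.2 ⟨x, rfl⟩)
  set e : (ι →₀ ℝ) →ₗ[ℝ] M := (Finsupp.linearCombination ℝ v).codRestrict M hmem with he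
  set f : (ι →₀ ℝ) →ₗ[ℝ] K₂ := Finsupp.linearCombination ℝ w with hf
  have hinner : ∀ x y, inner ℝ (f x) (f y) = inner ℝ (e x) (e y) :=
    inner_linearCombination_eq h
  have hnorm : ∀ x, ‖f x‖ = ‖e x‖ := fun x => by
    rw [norm_eq_sqrt_real_inner, norm_eq_sqrt_real_inner, hinner]
  have hdense : DenseRange e := by
    intro x
    rw [mem_closure_iff_seq_limit]
    obtain ⟨x, hx⟩ := x
    have hx' : x ∈ closure (Submodule.span ℝ (Set.range v) : Set K₁) := hx
    obtain ⟨u, hu, hlim⟩ := mem_closure_iff_seq_limit.1 hx'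
    have hu' : ∀ n, ∃ c : ι →₀ ℝ, Finsupp.linearCombination ℝ v c = u n := fun n =>
      (Finsupp.mem_span_range_iff_exists_finsupp).1 (hu n)
    choose c hc using hu'
    refine ⟨fun n => e (c n), fun n => ⟨c n, rfl⟩, ?_⟩
    rw [tendsto_subtype_rng]
    simpa [he, hc] using hlim
  have hbound : ∃ C, ∀ x, ‖f x‖ ≤ C * ‖e x‖ := ⟨1, fun x => by rw [one_mul, hnorm]⟩
  set T : M →L[ℝ] K₂ := f.extendOfNorm e with hT
  have hTe : ∀ x, T (e x) = f x := LinearMap.extendOfNorm_eq hdense hbound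
  have hTinner : ∀ x y, inner ℝ (T x) (T y) = inner ℝ x y := by
    intro x y
    refine hdense.induction_on (p := fun x => inner ℝ (T x) (T y) = inner ℝ x y) x
      (isClosed_eq (by fun_prop) (by fun_prop)) fun a => ?_
    refine hdense.induction_on (p := fun y => inner ℝ (T (e a)) (T y) = inner ℝ (e a) y) y
      (isClosed_eq (by fun_prop) (by fun_prop)) fun b => ?_
    rw [hTe, hTe, hinner]
  have hTmem : ∀ x, T x ∈ (Submodule.span ℝ (Set.range w)).topologicalClosure := by
    intro x
    refine hdense.induction_on
      (p := fun x => T x ∈ (Submodule.span ℝ (Set.range w)).topologicalClosure) x ?_ fun a => ?_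
    · exact (Submodule.isClosed_topologicalClosure _).preimage T.continuous
    · rw [hTe]
      exact Submodule.le_topologicalClosure _ (Finsupp.mem_span_range_iff_exists_finsupp.2 ⟨a, rfl⟩)
  have hv : ∀ i, v i ∈ M := fun i =>
    Submodule.le_topologicalClosure _ (Submodule.subset_span ⟨i, rfl⟩)
  -- The isometry `T` acts on the component in `M`, the second map keeps the orthogonal component,
  -- and the inner product identity is Pythagoras' theorem.
  refine ⟨T ∘L M.orthogonalProjectionOnto, ContinuousLinearMap.id ℝ K₁ - M.starProjection,
    fun x y => ?_, fun i => ?_, fun i => ?_, fun x => hTmem _⟩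
  · have hx := M.sub_starProjection_mem_orthogonal x
    have hy := M.sub_starProjection_mem_orthogonal y
    have h1 : inner ℝ (M.starProjection x) (y - M.starProjection y) = 0 :=
      hy _ (M.starProjection_apply_mem x)
    have h2 : inner ℝ (x - M.starProjection x) (M.starProjection y) = 0 := by
      rw [real_inner_comm]; exact hx _ (M.starProjection_apply_mem y)
    rw [LinearIsometry.inner_map_map]
    simp only [ContinuousLinearMap.comp_apply, hTinner, Submodule.coe_inner,
      sub_apply, ContinuousLinearMap.id_apply]
    have e1 : ((M.orthogonalProjectionOnto x : M) : K₁) = M.starProjection x := rfl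
    have e2 : ((M.orthogonalProjectionOnto y : M) : K₁) = M.starProjection y := rfl
    rw [e1, e2]
    calc _ = inner ℝ (M.starProjection x) (M.starProjection y) +
            inner ℝ (M.starProjection x) (y - M.starProjection y) +
            inner ℝ (x - M.starProjection x) (M.starProjection y) +
            inner ℝ (x - M.starProjection x) (y - M.starProjection y) := by rw [h1, h2]; ring
      _ = inner ℝ (M.starProjection x + (x - M.starProjection x))
            (M.starProjection y + (y - M.starProjection y)) := by
          simp only [inner_add_left, inner_add_right]; ring
      _ = inner ℝ x y := by simp
  · have e1 : M.orthogonalProjectionOnto (v i) = e (Finsupp.single i 1) := by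
      ext
      have : ((M.orthogonalProjectionOnto (v i) : M) : K₁) = M.starProjection (v i) := rfl
      rw [this, Submodule.starProjection_eq_self_iff.2 (hv i)]
      simp [he]
    rw [ContinuousLinearMap.comp_apply, e1, hTe]
    simp [hf]
  · simp [Submodule.starProjection_eq_self_iff.2 (hv i)]

end HilbertExtension

/-! ### Embedding `L²(ℝ)` into the functions odd in `k`. -/

section OddTensor

variable {d : ℕ}

lemma flipK_involutive (d : ℕ) : Function.Involutive (flipK d) := fun p => by simp [flipK]

lemma measurePreserving_flipK (d : ℕ) :
    MeasurePreserving (flipK d) (volume : Measure (ℝ × EuclideanSpace ℝ (Fin d))) volume :=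
  (MeasurePreserving.id (volume : Measure ℝ)).prod
    (Measure.measurePreserving_neg (volume : Measure (EuclideanSpace ℝ (Fin d))))

/-- There is an odd function of unit norm in `L²(ℝᵈ)`. -/
lemma exists_odd_memLp (hd : 1 ≤ d) : ∃ χ : EuclideanSpace ℝ (Fin d) → ℝ, MemLp χ 2 ∧
    (∀ k, χ (-k) = -χ k) ∧ ∫ k, χ k * χ k = 1 := by
  let i : Fin d := ⟨0, hd⟩
  let χ : EuclideanSpace ℝ (Fin d) → ℝ := fun k => k i * max 0 (1 - ‖k‖)
  have hc : Continuous χ := by fun_prop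
  have hsupp : HasCompactSupport χ := by
    refine HasCompactSupport.of_support_subset_isCompact (isCompact_closedBall 0 1) fun k hk => ?_
    rw [mem_closedBall_zero_iff]
    by_contra! h
    exact hk (by simp only [χ]; rw [max_eq_left (by linarith), mul_zero])
  have hodd : ∀ k, χ (-k) = -χ k := fun k => by simp [χ]
  have hpos : 0 < ∫ k, χ k * χ k := by
    refine (hc.mul hc).integral_pos_of_hasCompactSupport_nonneg_nonzero
      (x := EuclideanSpace.single i (1 / 2)) (hsupp.mul_left) (fun k => mul_self_nonneg _) ?_
    simp only [χ, PiLp.norm_single, PiLp.single_apply, if_true]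
    norm_num
  set I := ∫ k, χ k * χ k with hI
  refine ⟨fun k => (√I)⁻¹ * χ k, (hc.memLp_of_hasCompactSupport hsupp).const_mul _, fun k => ?_, ?_⟩
  · simp only [hodd]; ring
  · have e : ∀ k, (√I)⁻¹ * χ k * ((√I)⁻¹ * χ k) = I⁻¹ * (χ k * χ k) := fun k => by
      calc _ = (√I * √I)⁻¹ * (χ k * χ k) := by rw [mul_inv]; ring
        _ = _ := by rw [Real.mul_self_sqrt hpos.le]
    simp_rw [e]
    rw [integral_const_mul, ← hI, inv_mul_cancel₀ hpos.ne']

variable {X Y : Type*} [MeasurableSpace X] [MeasurableSpace Y] {μ : Measure X} {ν : Measure Y}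

lemma memLp_mul_prod {f : X → ℝ} {χ : Y → ℝ} (hf : MemLp f 2 μ) (hχ : MemLp χ 2 ν) :
    MemLp (fun p : X × Y => f p.1 * χ p.2) 2 (μ.prod ν) := by
  have hm : AEStronglyMeasurable (fun p : X × Y => f p.1 * χ p.2) (μ.prod ν) :=
    hf.1.comp_fst.mul hχ.1.comp_snd
  rw [memLp_two_iff_integrable_sq hm]
  simpa only [mul_pow] using hf.integrable_sq.mul_prod hχ.integrable_sq

variable [SFinite μ] [SFinite ν]

/-- Tensoring with a unit vector is an isometric embedding. -/
lemma exists_tensor_isometry {χ : Y → ℝ} (hχ : MemLp χ 2 ν) (h1 : ∫ y, χ y * χ y ∂ν = 1) :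
    ∃ V : Lp ℝ 2 μ →ₗᵢ[ℝ] Lp ℝ 2 (μ.prod ν),
      ∀ f, V f =ᵐ[μ.prod ν] fun p => f p.1 * χ p.2 := by
  have hm : ∀ f : Lp ℝ 2 μ, MemLp (fun p : X × Y => f p.1 * χ p.2) 2 (μ.prod ν) :=
    fun f => memLp_mul_prod (Lp.memLp f) hχ
  let V : Lp ℝ 2 μ →ₗ[ℝ] Lp ℝ 2 (μ.prod ν) :=
    { toFun f := (hm f).toLp _
      map_add' f g := by
        refine Lp.ext ?_
        filter_upwards [(hm (f + g)).coeFn_toLp, (hm f).coeFn_toLp, (hm g).coeFn_toLp,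
          Lp.coeFn_add ((hm f).toLp _) ((hm g).toLp _),
          Measure.quasiMeasurePreserving_fst.ae (Lp.coeFn_add f g)] with p h1 h2 h3 h4 h5
        rw [h1, h4, Pi.add_apply, h2, h3, h5, Pi.add_apply, add_mul]
      map_smul' c f := by
        refine Lp.ext ?_
        filter_upwards [(hm (c • f)).coeFn_toLp, (hm f).coeFn_toLp,
          Lp.coeFn_smul c ((hm f).toLp _),
          Measure.quasiMeasurePreserving_fst.ae (Lp.coeFn_smul c f)] with p h1 h2 h3 h4
        rw [h1, RingHom.id_apply, h3, Pi.smul_apply, h2, h4, Pi.smul_apply, smul_eq_mul,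
          smul_eq_mul, mul_assoc] }
  refine ⟨V.isometryOfInner fun f g => ?_, fun f => (hm f).coeFn_toLp⟩
  rw [L2.inner_def, L2.inner_def]
  have e : ∀ᵐ p ∂(μ.prod ν), inner ℝ (V f p) (V g p) = (g p.1 * f p.1) * (χ p.2 * χ p.2) := by
    filter_upwards [(hm f).coeFn_toLp, (hm g).coeFn_toLp] with p h1 h2
    change inner ℝ ((hm f).toLp _ p) ((hm g).toLp _ p) = _
    rw [h1, h2]
    simp only [RCLike.inner_apply, conj_trivial]
    ring
  rw [integral_congr_ae e, integral_prod_mul (fun x => g x * f x) (fun y => χ y * χ y), h1, mul_one]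
  simp only [RCLike.inner_apply, conj_trivial]

end OddTensor

/-! ### The isometry from `L²(ℝ)` into `L²_(s)`. -/

section NoiseTransfer

variable {d : ℕ}

/-- The real part of an element of `L²_(s)`. -/
noncomputable def reLp {E : Type*} [MeasureSpace E] {τ : E → E} (φ : SymmL2 τ) :
    Lp ℝ 2 (volume : Measure E) := φ.memLp.re.toLp _

lemma coeFn_reLp {E : Type*} [MeasureSpace E] {τ : E → E} (φ : SymmL2 τ) :
    reLp φ =ᵐ[volume] fun x => (φ.1 x).re := φ.memLp.re.coeFn_toLp

lemma inner_reLp (φ ψ : SymmL2 (id : ℝ → ℝ)) : inner ℝ (reLp φ) (reLp ψ) = pairing φ ψ := by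
  have h : ∫ x, (starRingEnd ℂ) (φ.1 x) * ψ.1 x = (pairing φ ψ : ℂ) :=
    integral_conj_mul_eq_pairing (MeasurePreserving.id _) (fun _ => rfl) φ ψ
  rw [← Complex.ofReal_inj, ← h, L2.inner_def, ← integral_complex_ofReal]
  refine integral_congr_ae ?_
  filter_upwards [coeFn_reLp φ, coeFn_reLp ψ, φ.conj_ae, ψ.conj_ae] with x h1 h2 h3 h4
  have h3' := Complex.conj_eq_iff_re.1 h3
  have h4' := Complex.conj_eq_iff_re.1 h4
  rw [h1, h2, h3, id, ← h3', ← h4', ← Complex.ofReal_mul]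
  simp [mul_comm]

/-- Evenness in `k` is being fixed by the isometry of composition with `flipK`, a closed linear
condition, so it passes to closed spans. -/
lemma mem_eqLocus_of_mem_closure {d : ℕ} {ι : Type*}
    {w : ι → Lp ℝ 2 (volume : Measure (ℝ × EuclideanSpace ℝ (Fin d)))}
    (hw : ∀ i, w i ∘ flipK d =ᵐ[volume] w i)
    {u : Lp ℝ 2 (volume : Measure (ℝ × EuclideanSpace ℝ (Fin d)))}
    (hu : u ∈ (Submodule.span ℝ (Set.range w)).topologicalClosure) :
    u ∘ flipK d =ᵐ[volume] u := by
  let T := Lp.compMeasurePreservingₗᵢ ℝ (E := ℝ) (p := 2) (flipK d) (measurePreserving_flipK d)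
  have hT : ∀ v, T v =ᵐ[volume] v ∘ flipK d := fun v =>
    Lp.coeFn_compMeasurePreserving v (measurePreserving_flipK d)
  have hle : (Submodule.span ℝ (Set.range w)).topologicalClosure ≤
      LinearMap.eqLocus T.toLinearMap LinearMap.id := by
    refine Submodule.topologicalClosure_minimal _ (Submodule.span_le.2 ?_)
      (isClosed_eq T.continuous continuous_id)
    rintro _ ⟨i, rfl⟩
    exact Lp.ext ((hT (w i)).trans (hw i))
  have h : T u = u := hle hu
  have h2 := hT u
  rw [h] at h2
  exact h2.symm

/-- Two families of functions with the same Gram kernel, on the line and on `ℝ × ℝᵈ`, are related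
by an isometry of `L²(ℝ)` into the sum of the even and of the odd functions in `L²(ℝ × ℝᵈ)`. -/
lemma exists_even_odd_isometry (hd : 1 ≤ d) {F : ℝ → ℝ → ℝ}
    {G : ℝ → ℝ × EuclideanSpace ℝ (Fin d) → ℝ} {H C : ℝ} (hF : HasPowerGram volume F H C)
    (hG : HasPowerGram volume G H C) (hH : 1 / 2 < H) (hsG : ∀ σ x, G σ (flipK d x) = G σ x) :
    ∃ U₁ U₂ : Lp ℝ 2 (volume : Measure ℝ) →
        Lp ℝ 2 (volume : Measure (ℝ × EuclideanSpace ℝ (Fin d))),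
      (∀ f g, inner ℝ (U₁ f) (U₁ g) + inner ℝ (U₂ f) (U₂ g) = inner ℝ f g) ∧
      (∀ f, U₁ f ∘ flipK d =ᵐ[volume] U₁ f) ∧
      (∀ f, ∀ᵐ x, U₂ f (flipK d x) = - U₂ f x) ∧
      (∀ (S : BddSet) (c : ℝ), U₁ (c • (hF.memLp_setFun hH S).toLp _) =ᵐ[volume]
        fun x => c * setFun G S.1 x) ∧
      ∀ (S : BddSet) (c : ℝ), U₂ (c • (hF.memLp_setFun hH S).toLp _) = 0 := by
  obtain ⟨χ, hχ, hodd, hone⟩ := exists_odd_memLp hd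
  obtain ⟨V, hV⟩ := exists_tensor_isometry (μ := (volume : Measure ℝ)) hχ hone
  -- Indexing by all bounded sets at once yields a single isometry, hence a single noise, valid for
  -- every `t` and every partition.
  let v : BddSet → Lp ℝ 2 (volume : Measure ℝ) := fun S => (hF.memLp_setFun hH S).toLp _
  let w : BddSet → Lp ℝ 2 (volume : Measure (ℝ × EuclideanSpace ℝ (Fin d))) := fun S =>
    (hG.memLp_setFun hH S).toLp _
  have hvw : ∀ S S', inner ℝ (v S) (v S') = inner ℝ (w S) (w S') := fun S S' =>
    (hF.inner_setFun hH S S').trans (hG.inner_setFun hH S S').symm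
  obtain ⟨U₁, U₂, hU, hUv, hU2, hmem⟩ := exists_isometric_pair hvw V
  have hfl := (measurePreserving_flipK d).quasiMeasurePreserving
  have hwf : ∀ S, w S =ᵐ[volume] setFun G S.1 := fun S => (hG.memLp_setFun hH S).coeFn_toLp
  have hw : ∀ S, w S ∘ flipK d =ᵐ[volume] w S := fun S => by
    filter_upwards [hwf S, hfl.ae (hwf S)] with x h1 h2
    rw [Function.comp_apply, h2, h1]
    simp only [setFun, setIntegral, hsG]
  have hVodd : ∀ f, ∀ᵐ x ∂(volume : Measure (ℝ × EuclideanSpace ℝ (Fin d))),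
      V f (flipK d x) = - V f x := fun f => by
    have h : ∀ᵐ x ∂(volume : Measure (ℝ × EuclideanSpace ℝ (Fin d))), V f x = f x.1 * χ x.2 := hV f
    filter_upwards [h, hfl.ae h] with x h1 h2
    rw [h1, h2]
    simp only [flipK, hodd, mul_neg]
  refine ⟨U₁, fun f => V (U₂ f), hU, fun f => mem_eqLocus_of_mem_closure hw (hmem f),
    fun f => hVodd _, fun S c => ?_, fun S c => ?_⟩
  · have e : U₁ (c • (hF.memLp_setFun hH S).toLp _) = c • w S :=
      (U₁.map_smul c (v S)).trans (congrArg (c • ·) (hUv S))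
    rw [e]
    filter_upwards [hwf S, Lp.coeFn_smul c (w S)] with x h1 h2
    rw [h2, Pi.smul_apply, h1, smul_eq_mul]
  · have e : U₂ (c • (hF.memLp_setFun hH S).toLp _) = 0 := by
      refine (U₂.map_smul c (v S)).trans ?_
      rw [hU2, smul_zero]
    simp only [e, map_zero]

lemma reLp_toSymm {E : Type*} [MeasureSpace E] [SFinite (volume : Measure E)] {τ : E → E}
    {F : ℝ → E → ℝ} {H C : ℝ} (hF : HasPowerGram volume F H C) (hH : 1 / 2 < H)
    (hs : ∀ σ x, F σ (τ x) = F σ x) (S : BddSet) (c : ℝ) :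
    reLp (hF.toSymm hH hs S c) = c • (hF.memLp_setFun hH S).toLp _ := by
  refine Lp.ext ?_
  filter_upwards [coeFn_reLp (hF.toSymm hH hs S c), (hF.memLp_setFun hH S).coeFn_toLp,
    Lp.coeFn_smul c ((hF.memLp_setFun hH S).toLp _)] with x h1 h2 h3
  rw [h1, h3, Pi.smul_apply, h2]
  simp [HasPowerGram.toSymm]

/-- The isometry between the `L²_(s)` spaces that relates two families of functions with the same
Gram kernel, on the line and on `ℝ × ℝᵈ`. -/
lemma exists_isometry_symmL2 (hd : 1 ≤ d) {F : ℝ → ℝ → ℝ}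
    {G : ℝ → ℝ × EuclideanSpace ℝ (Fin d) → ℝ} {H C : ℝ} (hF : HasPowerGram volume F H C)
    (hG : HasPowerGram volume G H C) (hH : 1 / 2 < H) (hsF : ∀ σ x, F σ (id x) = F σ x)
    (hsG : ∀ σ x, G σ (flipK d x) = G σ x) :
    ∃ U : SymmL2 (id : ℝ → ℝ) → SymmL2 (flipK d),
      (∀ φ ψ, pairing (U φ) (U ψ) = pairing φ ψ) ∧
      ∀ S w, (U (hF.toSymm hH hsF S w)).1 =ᵐ[volume] (hG.toSymm hH hsG S w).1 := by
  obtain ⟨U₁, U₂, hU, heven, hodd, hU1, hU2⟩ := exists_even_odd_isometry hd hF hG hH hsG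
  -- Conjugation changes the sign of the imaginary part, and so does `flipK` since `U₂` has odd
  -- values while `U₁` has even ones; hence `u φ` lies in `L²_(s)`.
  let u : SymmL2 (id : ℝ → ℝ) → ℝ × EuclideanSpace ℝ (Fin d) → ℂ := fun φ x =>
    (U₁ (reLp φ) x : ℂ) + Complex.I * (U₂ (reLp φ) x : ℂ)
  have hu : ∀ φ, MemLp (u φ) 2 := fun φ =>
    (Lp.memLp (U₁ (reLp φ))).ofReal (K := ℂ).add ((Lp.memLp (U₂ (reLp φ))).ofReal (K := ℂ).const_mul _)
  let U : SymmL2 (id : ℝ → ℝ) → SymmL2 (flipK d) := fun φ => ⟨u φ, hu φ, by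
    filter_upwards [heven (reLp φ), hodd (reLp φ)] with x h1 h2
    rw [Function.comp_apply] at h1
    simp only [u, map_add, map_mul, Complex.conj_ofReal, Complex.conj_I, h1, h2]
    push_cast; ring⟩
  refine ⟨U, fun φ ψ => ?_, fun S c => ?_⟩
  · have h := integral_conj_mul_eq_pairing (measurePreserving_flipK d) (flipK_involutive d)
      (U φ) (U ψ)
    have hint : Integrable (fun x => (starRingEnd ℂ) (u φ x) * u ψ x) :=
      (hu φ).star.integrable_mul (hu ψ)
    have hre := integral_re hint
    have h' : ∫ x, (starRingEnd ℂ) (u φ x) * u ψ x = (pairing (U φ) (U ψ) : ℂ) := h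
    rw [h'] at hre
    simp only [RCLike.re_eq_complex_re, Complex.ofReal_re] at hre
    rw [← hre, ← inner_reLp, ← hU, L2.inner_def, L2.inner_def, ← integral_add
      (L2.integrable_inner _ _) (L2.integrable_inner _ _)]
    refine integral_congr_ae (ae_of_all _ fun x => ?_)
    simp only [u, map_add, map_mul, Complex.conj_ofReal, Complex.conj_I, Complex.mul_re,
      Complex.add_re, Complex.add_im, Complex.mul_im, Complex.ofReal_re, Complex.ofReal_im,
      Complex.neg_re, Complex.neg_im, Complex.I_re, Complex.I_im, RCLike.inner_apply, conj_trivial]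
    ring
  · have e2 : U₂ (reLp (hF.toSymm hH hsF S c)) = 0 := by rw [reLp_toSymm]; exact hU2 S c
    have e1 : U₁ (reLp (hF.toSymm hH hsF S c)) =ᵐ[volume] fun x => c * setFun G S.1 x := by
      rw [reLp_toSymm]; exact hU1 S c
    have e3 : U₂ (reLp (hF.toSymm hH hsF S c)) =ᵐ[volume] 0 := by
      rw [e2]; exact Lp.coeFn_zero _ _ _
    filter_upwards [e1, e3] with x h1 h3
    change u (hF.toSymm hH hsF S c) x = ((c * setFun G S.1 x : ℝ) : ℂ)
    simp only [u]
    rw [h1, h3]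
    simp

end NoiseTransfer

/-! ### Transfer of the double integrals to a noise on the line. -/

section Rosenblatt

lemma half_lt_hurstIndex {α β : ℝ} (hβ : 0 < β) (hαβ : 1 < α + β) : 1 / 2 < hurstIndex α β := by
  rw [hurstIndex_eq, div_lt_div_iff₀ (by norm_num) (by positivity)]
  linarith

lemma hurstIndex_lt_one {α β : ℝ} (hβ : 0 < β) (hα : α < 1) : hurstIndex α β < 1 := by
  rw [hurstIndex_eq, div_lt_one (by positivity)]
  linarith

lemma zKernel_eq_integral_heatFamily {a₀ r₀ : ℝ} (ha₀ : 0 < a₀) (hr₀ : 0 < r₀) (α β : ℝ) {d : ℕ}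
    (t : ℝ) (p : (ℝ × EuclideanSpace ℝ (Fin d)) × (ℝ × EuclideanSpace ℝ (Fin d))) :
    zKernel a₀ r₀ α β t p =
      ∫ σ in (0 : ℝ)..t, heatFamily a₀ r₀ α β σ p.1 * heatFamily a₀ r₀ α β σ p.2 := by
  simp only [zKernel, heatFamily_mul ha₀ hr₀]

lemma sq_mul_rosenblattKernel (c H t : ℝ) (y : ℝ × ℝ) :
    c ^ 2 * rosenblattKernel H t y =
      ∫ σ in (0 : ℝ)..t, (c * rosFamily H σ y.1) * (c * rosFamily H σ y.2) := by
  rw [rosenblattKernel, ← intervalIntegral.integral_const_mul]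
  refine intervalIntegral.integral_congr fun σ _ => ?_
  simp only [rosFamily]
  ring

variable {Ω : Type*} [MeasurableSpace Ω] {P : Measure Ω} [IsProbabilityMeasure P] {d : ℕ}
  {ι : Type*} [DecidableEq ι] {W : ι → SymmL2 (flipK d) → Ω → ℝ}

omit [IsProbabilityMeasure P] in
lemma IsWhiteNoise.comp_isometry (hW : IsWhiteNoise P (flipK d) W) (j : ι)
    {U : SymmL2 (id : ℝ → ℝ) → SymmL2 (flipK d)}
    (hU : ∀ φ ψ, pairing (U φ) (U ψ) = pairing φ ψ) :
    IsWhiteNoise P (id : ℝ → ℝ) (fun (_ : Unit) φ => W j (U φ)) where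
  gaussian := hW.gaussian.comp_right fun q : Unit × SymmL2 (id : ℝ → ℝ) => (j, U q.2)
  mean _ φ := hW.mean j (U φ)
  cov _ _ φ ψ := by rw [hW.cov, if_pos rfl, if_pos rfl, hU]

/-- A double stochastic integral of a kernel `∫₀ᵗ G_σ ⊗ G_σ dσ` is also a double stochastic
integral, with respect to a white noise on the line, of `∫₀ᵗ F_σ ⊗ F_σ dσ` for every family `F`
with the same Gram kernel as `G`. -/
lemma exists_isWhiteNoise_isDoubleIntegral (hW : IsWhiteNoise P (flipK d) W) (hd : 1 ≤ d)
    {F : ℝ → ℝ → ℝ} {G : ℝ → ℝ × EuclideanSpace ℝ (Fin d) → ℝ} {H C : ℝ}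
    (hF : HasPowerGram volume F H C) (hG : HasPowerGram volume G H C) (hH : 1 / 2 < H)
    (hsG : ∀ σ x, G σ (flipK d x) = G σ x) (j : ι) :
    ∃ B : Unit → SymmL2 (id : ℝ → ℝ) → Ω → ℝ, IsWhiteNoise P id B ∧
      ∀ (t : ℝ≥0) (Z : Ω → ℝ),
        IsDoubleIntegral P (W j)
          (fun p => ((∫ σ in (0 : ℝ)..t, G σ p.1 * G σ p.2 : ℝ) : ℂ)) Z →
        IsDoubleIntegral P (B ())
          (fun p => ((∫ σ in (0 : ℝ)..t, F σ p.1 * F σ p.2 : ℝ) : ℂ)) Z := by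
  have hsF : ∀ σ x, F σ (id x) = F σ x := fun _ _ => rfl
  obtain ⟨U, hU, hUF⟩ := exists_isometry_symmL2 hd hF hG hH hsF hsG
  have hτ := measurePreserving_flipK d
  have hinv := flipK_involutive d
  refine ⟨fun _ φ => W j (U φ), hW.comp_isometry j hU, fun t Z hZ =>
    ⟨hF.memLp_kernel hH t, hZ.measurable, hZ.memLp, hF.cellList hH hsF t,
      hF.tendsto_elemKernel_cellList hH hsF t, ?_⟩⟩
  -- The cell lists of `F` and of `G` give almost surely the same elementary integrals, because `U`
  -- maps each cell average of `F` to that of `G`; so `Z` is the limit of both.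
  refine (hZ.tendsto hτ hinv hW (hG.tendsto_elemKernel_cellList hH hsG t)).congr fun n => ?_
  have hae : ∀ S w, W j (U (hF.toSymm hH hsF S w)) =ᵐ[P] W j (hG.toSymm hH hsG S w) :=
    fun S w => hW.ae_eq_of_ae_eq hτ j (hUF S w)
  have hpair : ∀ S w S' w', pairing (hF.toSymm hH hsF S w) (hF.toSymm hH hsF S' w') =
      pairing (hG.toSymm hH hsG S w) (hG.toSymm hH hsG S' w') := fun S w S' w' => by
    have h1 := hW.cov j j (U (hF.toSymm hH hsF S w)) (U (hF.toSymm hH hsF S' w'))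
    have h2 := hW.cov j j (hG.toSymm hH hsG S w) (hG.toSymm hH hsG S' w')
    rw [if_pos rfl] at h1 h2
    rw [← hU, ← h1, ← h2]
    refine integral_congr_ae ?_
    filter_upwards [hae S w, hae S' w'] with ω h3 h4
    rw [h3, h4]
  refine eLpNorm_congr_ae ?_
  filter_upwards [ae_all_iff.2 fun i : Fin n => hae (bddCell t i.2) (n / t),
    ae_all_iff.2 fun i : Fin n => hae (bddCell t i.2) 1] with ω h1 h2
  simp only [elemIntegral, HasPowerGram.cellList, List.map_ofFn, List.sum_ofFn,
    Function.comp_apply, h1, h2, hpair]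

end Rosenblatt

end ChaosProcess

theorem proposition2 {Ω : Type*} [MeasurableSpace Ω] (P : Measure Ω) [IsProbabilityMeasure P]
    (d : ℕ) (hd : 1 ≤ d) (a₀ r₀ α β : ℝ) (ha₀ : 0 < a₀) (hr₀ : 0 < r₀) (hβ : 0 < β)
    (hα : α < 1) (hαβ : 1 < α + β)
    (W : Fin d → ChaosProcess.SymmL2 (ChaosProcess.flipK d) → Ω → ℝ)
    (hW : ChaosProcess.IsWhiteNoise P (ChaosProcess.flipK d) W) :
    -- the variables `Z_j(t)` are well defined, up to almost sure equality
    (∀ (j : Fin d) (t : ℝ≥0), ∃ X : Ω → ℝ, ChaosProcess.IsZ P a₀ r₀ α β (W j) t X ∧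
      ∀ X' : Ω → ℝ, ChaosProcess.IsZ P a₀ r₀ α β (W j) t X' → X' =ᵐ[P] X) ∧
    -- and they form a `d`-dimensional Rosenblatt process of index `H`
    ∀ Z : Fin d → ℝ≥0 → Ω → ℝ,
      (∀ (j : Fin d) (t : ℝ≥0), ChaosProcess.IsZ P a₀ r₀ α β (W j) t (Z j t)) →
      ChaosProcess.IsRosenblattVector P (ChaosProcess.hurstIndex α β) Z := by
  open ChaosProcess in
  have hH := half_lt_hurstIndex hβ hαβ
  have hH1 := hurstIndex_lt_one hβ hα
  have hG := hasPowerGram_heatFamily hd ha₀ hr₀ hβ hα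
  have hsG := heatFamily_flipK (d := d) a₀ r₀ α β
  have hτ := measurePreserving_flipK d
  have hinv := flipK_involutive d
  unfold IsZ
  simp only [zKernel_eq_integral_heatFamily ha₀ hr₀]
  refine ⟨fun j t => ?_, fun Z hZ => ⟨iIndepFun_doubleIntegral hW hZ, fun j => ?_⟩⟩
  · obtain ⟨X, hX⟩ := exists_isDoubleIntegral hτ hinv hW j (hG.memLp_kernel hH t)
      (hG.tendsto_elemKernel_cellList hH hsG t)
    exact ⟨X, hX, fun X' hX' => hX.ae_eq hτ hinv hW hX'⟩
  · have hCG : 0 < a₀ * ∫ k, spatialGram d r₀ α β 1 k :=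
      mul_pos ha₀ (integral_spatialGram_pos hd hr₀ hβ hα one_pos)
    have hF := hasPowerGram_rosFamily (by linarith : 0 < hurstIndex α β) hH1
    have hCF := integral_rosFamily_mul_pos (by linarith : 0 < hurstIndex α β) hH1
    generalize (a₀ * ∫ k, spatialGram d r₀ α β 1 k) = A at hG hCG
    generalize (∫ u, rosFamily (hurstIndex α β) u 0 * rosFamily (hurstIndex α β) (1 + u) 0) = D
      at hF hCF
    -- Scaling a family by `√(A / D)` multiplies its Gram constant `D` by `A / D`, matching `A`. The
    -- kernel is quadratic in the family too, so the constant `c` is `A / D`.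
    have hF' := hF.const_mul (Real.sqrt_nonneg (A / D))
    have hsq : √(A / D) ^ 2 = A / D := Real.sq_sqrt (by positivity)
    rw [hsq, div_mul_cancel₀ _ hCF.ne'] at hF'
    obtain ⟨B, hB, hBZ⟩ := exists_isWhiteNoise_isDoubleIntegral hW hd hF' hG hH hsG j
    refine ⟨hH, hH1, A / D, by positivity, B, hB, fun t => ?_⟩
    have := hBZ t (Z j t) (hZ j t)
    simpa only [← sq_mul_rosenblattKernel, hsq] using this
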